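/- Let $\lambda>0$, $\sigma>0$, $n\ge 1$, $x_1,\dots,x_n\in\mathbb R^p$, $y_1,\dots,y_n\in\{-1,1\}$, and let $$L(w)=\tfrac{\lambda}{2}\|w\|^2+\tfrac1n\sum_{i=1}^n\psi(y_iw^Tx_i;\sigma),$$ where $\psi$ is one of the smooth Hinge losses $\psi_G(\alpha;\sigma)=\Phi(v)(1-\alpha)+\phi(v)\sigma$ or $\psi_M(\alpha;\sigma)=\Phi_M(v)(1-\alpha)+\phi_M(v)\sigma$ with $v=(1-\alpha)/\sigma$. Here $\Phi,\phi$ are the distribution function and the density of the standard normal law, $\Phi_M(v)=\frac12\bigl(1+v/\sqrt{1+v^2}\bigr)$ and $\phi_M(v)=1/(2\sqrt{1+v^2})$. Consider the following trust-region Newton method (TRON) with fixed parameters $0<\eta_0<\eta_1<\eta_2<1$ and $0<\delta_1<\delta_2<1<\delta_3$, tolerances $\xi_t\in[0,1)$, an arbitrary starting point $w_0$, and initial radius $\Delta_0=\|\nabla L(w_0)\|$. For $t=0,1,2,\dots$ put $g_t=\nabla L(w_t)$, $H_t=\nabla^2L(w_t)$. *Inner solver (conjugate gradients).* Start with $s^1=0$,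 $r^1=p^1=-g_t$. For $k=1,2,\dots$: if $\|r^k\|\le\xi_t\|g_t\|$, output $s_t=s^k$. Otherwise let $\alpha^k=\|r^k\|^2/\bigl((p^k)^TH_tp^k\bigr)$. If $\|s^k+\alpha^kp^k\|>\Delta_t$, output $s_t=s^k+\tau p^k$, where $$\tau=\frac{-(s^k)^Tp^k+\sqrt{((s^k)^Tp^k)^2+\|p^k\|^2(\Delta_t^2-\|s^k\|^2)}}{\|p^k\|^2}.$$ Otherwise set $s^{k+1}=s^k+\alpha^kp^k$, $r^{k+1}=r^k-\alpha^kH_tp^k$, $p^{k+1}=r^{k+1}+\bigl(\|r^{k+1}\|^2/\|r^k\|^2\bigr)p^k$ and continue. *Update.* Let $q_t(s)=g_t^Ts+\frac12s^TH_ts$ and $\rho_t=\bigl(L(w_t+s_t)-L(w_t)\bigr)/q_t(s_t)$ (with $\rho_t=0$ if $q_t(s_t)=0$). Set $w_{t+1}=w_t+s_t$ if $\rho_t>\eta_0$ and $w_{t+1}=w_t$ otherwise, and choose any $\Delta_{t+1}\in[\delta_1\min(\|s_t\|,\Delta_t),\,\delta_2\Delta_t]$ if $\rho_t\le\eta_1$,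 $\Delta_{t+1}\in[\delta_1\Delta_t,\,\delta_2\Delta_t]$ if $\eta_1<\rho_t<\eta_2$, and $\Delta_{t+1}\in[\Delta_t,\,\delta_3\Delta_t]$ if $\rho_t\ge\eta_2$. The method is run without a stopping threshold; if $g_t=0$ then $s_t=0$ and the iterates stay constant from then on. Then $L$ has a unique minimizer $w^\star$, and every sequence $(w_t)$ generated by this method converges to $w^\star$. Moreover: 1. (with only $0\le\xi_t<1$ for all $t$) the convergence is Q-linear: there is $c<1$ such that $\|w_{t+1}-w^\star\|\le c\,\|w_t-w^\star\|$ for all large $t$; 2. if $\xi_t\to0$, the convergence is Q-superlinear: for every $\varepsilon>0$, $\|w_{t+1}-w^\star\|\le\varepsilon\,\|w_t-w^\star\|$ for all large $t$; 3. if, for some constant $\kappa>0$, $\xi_t=\kappa\|\nabla L(w_t)\|$ for all large $t$, the convergence is quadratic: there is $C<\infty$ such that $\|w_{t+1}-w^\star\|\le C\,\|w_t-w^\star\|^2$ for all large $t$. -/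

import Mathlib

open Filter Topology ProbabilityTheory

noncomputable section

/-! ### The smooth Hinge losses and the objective -/

/-- `ψ_G(α; σ) = Φ(v) (1 - α) + φ(v) σ` with `v = (1 - α) / σ`, where `Φ` and `φ` are the
cumulative distribution function and the density of the standard normal distribution. -/
def psiG (σ α : ℝ) : ℝ :=
  cdf (gaussianReal 0 1) ((1 - α) / σ) * (1 - α) + gaussianPDFReal 0 1 ((1 - α) / σ) * σ

/-- `Φ_M(v) = (1 + v / √(1 + v ^ 2)) / 2`. -/
def PhiM (v : ℝ) : ℝ := (1 + v / √(1 + v ^ 2)) / 2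

/-- `φ_M(v) = 1 / (2 √(1 + v ^ 2))`. -/
def phiM (v : ℝ) : ℝ := 1 / (2 * √(1 + v ^ 2))

/-- `ψ_M(α; σ) = Φ_M(v) (1 - α) + φ_M(v) σ` with `v = (1 - α) / σ`. -/
def psiM (σ α : ℝ) : ℝ :=
  PhiM ((1 - α) / σ) * (1 - α) + phiM ((1 - α) / σ) * σ

/-- The regularized empirical risk `L(w) = λ/2 ‖w‖² + (1/n) ∑ i, ψ(y i * ⟨w, x i⟩)`. -/
def svmObjective {p n : ℕ} (ψ : ℝ → ℝ) (lam : ℝ) (x : Fin n → EuclideanSpace ℝ (Fin p))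
    (y : Fin n → ℝ) (w : EuclideanSpace ℝ (Fin p)) : ℝ :=
  1 / 2 * lam * ‖w‖ ^ 2 + 1 / (n : ℝ) * ∑ i, ψ (y i * inner ℝ w (x i))

section Algorithm

variable {E : Type*} [NormedAddCommGroup E] [InnerProductSpace ℝ E]

/-! ### The conjugate gradient inner solver -/

/-- The variables of the conjugate gradient loop: the iterate `s`, the residual `r` and the search
direction `p`. -/
structure CGState (E : Type*) where
  s : E
  r : E
  p : E

/-- The full step length `α = ⟨r, r⟩ / ⟨p, H p⟩`. -/
def CGState.alpha (H : E →L[ℝ] E) (S : CGState E) : ℝ :=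
  inner ℝ S.r S.r / inner ℝ S.p (H S.p)

/-- The step length `τ` that leads from `s` along `p` to the boundary of the trust region. -/
def CGState.tau (Δ : ℝ) (S : CGState E) : ℝ :=
  (-inner ℝ S.s S.p + √((inner ℝ S.s S.p) ^ 2 + ‖S.p‖ ^ 2 * (Δ ^ 2 - ‖S.s‖ ^ 2))) / ‖S.p‖ ^ 2

/-- One pass through the loop body, when it does not terminate. -/
def CGState.next (H : E →L[ℝ] E) (S : CGState E) : CGState E :=
  let r' := S.r - S.alpha H • H S.p
  { s := S.s + S.alpha H • S.p
    r := r'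
    p := r' + (inner ℝ r' r' / inner ℝ S.r S.r) • S.p }

/-- The successive states of the loop (numbered from `0`) for the model with gradient `g` and
Hessian `H`. -/
def cgSeq (H : E →L[ℝ] E) (g : E) : ℕ → CGState E
  | 0 => ⟨0, -g, -g⟩
  | k + 1 => (cgSeq H g k).next H

/-- The residual test `‖r‖ ≤ ξ ‖g‖` succeeds in pass `k`. -/
def CGConverged (H : E →L[ℝ] E) (g : E) (ξ : ℝ) (k : ℕ) : Prop :=
  ‖(cgSeq H g k).r‖ ≤ ξ * ‖g‖

/-- The full step of pass `k` stays in the trust region. -/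
def CGInside (H : E →L[ℝ] E) (g : E) (Δ : ℝ) (k : ℕ) : Prop :=
  ‖(cgSeq H g k).s + (cgSeq H g k).alpha H • (cgSeq H g k).p‖ ≤ Δ

/-- `s` is the output of the conjugate gradient method with radius `Δ` and tolerance `ξ`: the first
`k` passes do not terminate, and pass `k` terminates with `s`, either because the residual is small
or because the full step would leave the trust region. -/
def CGOutput (H : E →L[ℝ] E) (g : E) (Δ ξ : ℝ) (s : E) : Prop :=
  ∃ k : ℕ, (∀ j < k, ¬ CGConverged H g ξ j ∧ CGInside H g Δ j) ∧
    ((CGConverged H g ξ k ∧ s = (cgSeq H g k).s) ∨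
      (¬ CGConverged H g ξ k ∧ ¬ CGInside H g Δ k ∧
        s = (cgSeq H g k).s + (cgSeq H g k).tau Δ • (cgSeq H g k).p))

/-! ### The trust region Newton method -/

variable [CompleteSpace E]

/-- The Hessian of `f` at `w`, the derivative of the gradient. -/
def hessian (f : E → ℝ) (w : E) : E →L[ℝ] E := fderiv ℝ (gradient f) w

/-- The quadratic model `q(s) = ⟨∇f(w), s⟩ + ½ ⟨s, ∇²f(w) s⟩`. -/
def quadModel (f : E → ℝ) (w s : E) : ℝ :=
  inner ℝ (gradient f w) s + 1 / 2 * inner ℝ s (hessian f w s)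

/-- The ratio `ρ = (f(w + s) - f(w)) / q(s)` of the actual and the predicted reduction. -/
def reductionRatio (f : E → ℝ) (w s : E) : ℝ := (f (w + s) - f w) / quadModel f w s

/-- The parameters of the acceptance test and of the radius update. -/
structure TRParams where
  η₀ : ℝ
  η₁ : ℝ
  η₂ : ℝ
  δ₁ : ℝ
  δ₂ : ℝ
  δ₃ : ℝ

/-- The usual restrictions on the parameters; the customary values
`10⁻⁴, 1/4, 3/4` and `1/4, 1/2, 4` satisfy them. -/
structure TRParams.Admissible (P : TRParams) : Prop where
  η₀_pos : 0 < P.η₀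
  η₀_lt_η₁ : P.η₀ < P.η₁
  η₁_lt_η₂ : P.η₁ < P.η₂
  η₂_lt_one : P.η₂ < 1
  δ₁_pos : 0 < P.δ₁
  δ₁_lt_δ₂ : P.δ₁ < P.δ₂
  δ₂_lt_one : P.δ₂ < 1
  one_lt_δ₃ : 1 < P.δ₃

open Classical in
/-- `w` (iterates), `Δ` (radii) and `s` (steps) form a run of the trust region Newton method on `f`
with conjugate gradient tolerances `ξ`. The radius update is free within the prescribed intervals.
The run is not cut off by a stopping threshold; at a point where the gradient vanishes the step
is `0`, so from then on the iterates are constant. -/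
structure IsTRONRun (f : E → ℝ) (P : TRParams) (ξ : ℕ → ℝ) (w : ℕ → E) (Δ : ℕ → ℝ)
    (s : ℕ → E) : Prop where
  radius_zero : Δ 0 = ‖gradient f (w 0)‖
  step : ∀ t, CGOutput (hessian f (w t)) (gradient f (w t)) (Δ t) (ξ t) (s t)
  update : ∀ t, w (t + 1) = if P.η₀ < reductionRatio f (w t) (s t) then w t + s t else w t
  radius_low : ∀ t, reductionRatio f (w t) (s t) ≤ P.η₁ →
    Δ (t + 1) ∈ Set.Icc (P.δ₁ * min ‖s t‖ (Δ t)) (P.δ₂ * Δ t)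
  radius_mid : ∀ t, P.η₁ < reductionRatio f (w t) (s t) → reductionRatio f (w t) (s t) < P.η₂ →
    Δ (t + 1) ∈ Set.Icc (P.δ₁ * Δ t) (P.δ₂ * Δ t)
  radius_high : ∀ t, P.η₂ ≤ reductionRatio f (w t) (s t) →
    Δ (t + 1) ∈ Set.Icc (Δ t) (P.δ₃ * Δ t)

/-! ### Rates of convergence (free of division, so that `w t = a` is allowed) -/

/-- `limsup ‖w (t+1) - a‖ / ‖w t - a‖ < 1`. -/
def QLinearRate (w : ℕ → E) (a : E) : Prop :=
  ∃ c : ℝ, c < 1 ∧ ∀ᶠ t in atTop, ‖w (t + 1) - a‖ ≤ c * ‖w t - a‖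

/-- `lim ‖w (t+1) - a‖ / ‖w t - a‖ = 0`. -/
def QSuperlinearRate (w : ℕ → E) (a : E) : Prop :=
  ∀ ε : ℝ, 0 < ε → ∀ᶠ t in atTop, ‖w (t + 1) - a‖ ≤ ε * ‖w t - a‖

/-- `limsup ‖w (t+1) - a‖ / ‖w t - a‖² < ∞`. -/
def QQuadraticRate (w : ℕ → E) (a : E) : Prop :=
  ∃ C : ℝ, ∀ᶠ t in atTop, ‖w (t + 1) - a‖ ≤ C * ‖w t - a‖ ^ 2

end Algorithm

end

/-! The regularizer and the bounded, Lipschitz second derivative of the loss confine every Hessian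
to a spectral interval [l, u] with l = λ > 0 and make it Lipschitz in w. Everything about the method
uses only this (`RegularObjective`).

Global convergence: each CG output lowers the quadratic model by at least (l/2)‖s‖², while the model
is accurate to O(‖s‖³). Short steps therefore have ratio at least η₂, and the radii stay away from
zero (`exists_radius_ge`). If the gradients stayed large, every accepted step would lower f by a
fixed amount, so from some time on all steps would be rejected and the radii would shrink to zero.
Hence the gradients come close to zero, and monotone function values with strong convexity give
convergence (`tendsto`).

Rates: eventually the steps lie strictly inside the trust region and are accepted, so they are
inexact Newton steps. The exact Newton step b has quadratic error, and the residual test bounds s −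
b in terms of ξ; this gives the superlinear and quadratic rates. It does not give the linear rate,
since ξ may tend to 1. There the reason is that CG directions have pairwise nonnegative inner
products, so the Euclidean distance to b decreases from pass to pass, and the first pass, always
performed because ξ < 1, already yields ‖s − b‖² ≤ (1 − (l/u)²)‖b‖² (`cgSeq_error_le`). -/

/-! ### Conjugate gradients for a positive definite operator. -/

section ConjugateGradient

variable {E : Type*} [NormedAddCommGroup E] [InnerProductSpace ℝ E]

open scoped RealInnerProductSpace

/-- `H` is symmetric with spectrum in `[l, u]`. -/
structure SpectralBounds (H : E →L[ℝ] E) (l u : ℝ) : Prop where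
  symm : ∀ a b, ⟪a, H b⟫ = ⟪H a, b⟫
  pos : 0 < l
  le : l ≤ u
  lower : ∀ a, l * ‖a‖ ^ 2 ≤ ⟪a, H a⟫
  upper : ∀ a, ‖H a‖ ≤ u * ‖a‖

namespace SpectralBounds

variable {H : E →L[ℝ] E} {l u : ℝ}

theorem upper_pos (hH : SpectralBounds H l u) : 0 < u := hH.pos.trans_le hH.le

theorem symm' (hH : SpectralBounds H l u) (a b : E) : ⟪a, H b⟫ = ⟪b, H a⟫ := by
  rw [hH.symm, real_inner_comm]

theorem inner_pos (hH : SpectralBounds H l u) {a : E} (ha : a ≠ 0) : 0 < ⟪a, H a⟫ :=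
  lt_of_lt_of_le (mul_pos hH.pos (pow_pos (norm_pos_iff.2 ha) 2)) (hH.lower a)

theorem inner_nonneg (hH : SpectralBounds H l u) (a : E) : 0 ≤ ⟪a, H a⟫ :=
  le_trans (mul_nonneg hH.pos.le (sq_nonneg _)) (hH.lower a)

theorem inner_le (hH : SpectralBounds H l u) (a : E) : ⟪a, H a⟫ ≤ u * ‖a‖ ^ 2 := by
  have h1 := real_inner_le_norm a (H a)
  have h2 := mul_le_mul_of_nonneg_left (hH.upper a) (norm_nonneg a)
  nlinarith

theorem lower_norm (hH : SpectralBounds H l u) (a : E) : l * ‖a‖ ≤ ‖H a‖ := by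
  rcases (norm_nonneg a).eq_or_lt with h | h
  · rw [← h, mul_zero]; exact norm_nonneg _
  · have h1 := hH.lower a
    have h2 := real_inner_le_norm a (H a)
    nlinarith

theorem injective (hH : SpectralBounds H l u) : Function.Injective H := by
  refine (injective_iff_map_eq_zero H).2 fun a ha => ?_
  by_contra h
  have := hH.inner_pos h
  rw [ha, inner_zero_right] at this
  exact this.false

theorem exists_apply_eq [FiniteDimensional ℝ E] (hH : SpectralBounds H l u) (b : E) :
    ∃ a, H a = b :=
  (LinearMap.injective_iff_surjective (f := (H : E →ₗ[ℝ] E))).1 hH.injective b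

end SpectralBounds

variable {H : E →L[ℝ] E} {l u : ℝ} {g : E}

theorem cgSeq_succ_s (k : ℕ) : (cgSeq H g (k + 1)).s
    = (cgSeq H g k).s + (cgSeq H g k).alpha H • (cgSeq H g k).p := rfl

theorem cgSeq_succ_r (k : ℕ) : (cgSeq H g (k + 1)).r
    = (cgSeq H g k).r - (cgSeq H g k).alpha H • H (cgSeq H g k).p := rfl

theorem cgSeq_succ_p (k : ℕ) : (cgSeq H g (k + 1)).p = (cgSeq H g (k + 1)).r +
    (⟪(cgSeq H g (k + 1)).r, (cgSeq H g (k + 1)).r⟫ / ⟪(cgSeq H g k).r, (cgSeq H g k).r⟫) •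
      (cgSeq H g k).p := rfl

/-- `cgSeq` ignores the stopping tests. Once the residual vanishes, so does the direction, and the
convention 0 / 0 = 0 freezes the state; the CG identities thus hold for every k. -/
theorem cgSeq_p_eq_zero {k : ℕ} (h : (cgSeq H g k).r = 0) : (cgSeq H g k).p = 0 := by
  cases k with
  | zero => exact h
  | succ k => rw [cgSeq_succ_p, h]; simp

theorem cgSeq_r_eq (k : ℕ) : (cgSeq H g k).r = -g - H (cgSeq H g k).s := by
  induction k with
  | zero => simp [cgSeq]
  | succ k ih => rw [cgSeq_succ_r, cgSeq_succ_s, ih, map_add, map_smul]; abel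

/-- Orthogonality of the residual to the previous directions, and conjugacy of the directions. -/
theorem cgSeq_orthogonality (hH : SpectralBounds H l u) (k : ℕ) :
    (∀ i < k, ⟪(cgSeq H g k).r, (cgSeq H g i).p⟫ = 0) ∧
    (∀ i < k, ⟪(cgSeq H g k).p, H (cgSeq H g i).p⟫ = 0) ∧
    ⟪(cgSeq H g k).r, (cgSeq H g k).p⟫ = ⟪(cgSeq H g k).r, (cgSeq H g k).r⟫ := by
  induction k with
  | zero => simp [cgSeq]
  | succ k ih =>
    obtain ⟨h1, h2, h3⟩ := ih
    have hα : (cgSeq H g k).alpha H * ⟪(cgSeq H g k).p, H (cgSeq H g k).p⟫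
        = ⟪(cgSeq H g k).r, (cgSeq H g k).r⟫ := by
      by_cases hr : (cgSeq H g k).r = 0
      · rw [cgSeq_p_eq_zero hr, hr]; simp
      · have hp : (cgSeq H g k).p ≠ 0 := by
          intro hp
          rw [hp, inner_zero_right] at h3
          exact hr (inner_self_eq_zero.1 h3.symm)
        exact div_mul_cancel₀ _ (hH.inner_pos hp).ne'
    have hrp : ∀ i < k + 1, ⟪(cgSeq H g (k + 1)).r, (cgSeq H g i).p⟫ = 0 := by
      intro i hi
      rw [cgSeq_succ_r, inner_sub_left, real_inner_smul_left, ← hH.symm]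
      rcases Nat.lt_succ_iff_lt_or_eq.1 hi with hi | rfl
      · rw [h1 i hi, h2 i hi]; simp
      · rw [h3, hα]; simp
    -- Each residual is a combination of two consecutive directions, so orthogonality to directions
    -- gives orthogonality to residuals.
    have hrr : ∀ i < k + 1, ⟪(cgSeq H g (k + 1)).r, (cgSeq H g i).r⟫ = 0 := by
      intro i hi
      cases i with
      | zero => exact hrp 0 hi
      | succ i =>
        have e : (cgSeq H g (i + 1)).r = (cgSeq H g (i + 1)).p -
          (⟪(cgSeq H g (i + 1)).r, (cgSeq H g (i + 1)).r⟫ / ⟪(cgSeq H g i).r, (cgSeq H g i).r⟫) •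
            (cgSeq H g i).p := by rw [cgSeq_succ_p]; abel
        rw [e, inner_sub_right, real_inner_smul_right, hrp _ hi, hrp i (by omega)]; simp
    -- α H pᵢ = rᵢ − rᵢ₊₁ reduces conjugacy to orthogonality of residuals, after cancelling α ≠ 0.
    have hrH : ∀ i, (cgSeq H g i).alpha H * ⟪(cgSeq H g (k + 1)).r, H (cgSeq H g i).p⟫
        = ⟪(cgSeq H g (k + 1)).r, (cgSeq H g i).r⟫
          - ⟪(cgSeq H g (k + 1)).r, (cgSeq H g (i + 1)).r⟫ := by
      intro i
      rw [cgSeq_succ_r i, inner_sub_right, real_inner_smul_right]; ring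
    refine ⟨hrp, fun i hi => ?_, ?_⟩
    · by_cases hp : (cgSeq H g i).p = 0
      · rw [hp]; simp
      have hr : (cgSeq H g i).r ≠ 0 := fun h => hp (cgSeq_p_eq_zero h)
      have hr' : 0 < ⟪(cgSeq H g i).r, (cgSeq H g i).r⟫ := real_inner_self_pos.2 hr
      have ha : (cgSeq H g i).alpha H ≠ 0 := (div_pos hr' (hH.inner_pos hp)).ne'
      refine (mul_eq_zero.1 ?_).resolve_left ha
      rw [cgSeq_succ_p, inner_add_left, real_inner_smul_left, mul_add, hrH, hrr i hi]
      rcases Nat.lt_succ_iff_lt_or_eq.1 hi with hi | rfl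
      · rw [h2 i hi, hrr (i + 1) (by omega)]; simp
      · rw [mul_left_comm, hα, div_mul_cancel₀ _ hr'.ne']; ring
    · rw [cgSeq_succ_p, inner_add_right, real_inner_smul_right, hrp k (by omega)]; simp

theorem cgSeq_inner_r_p (hH : SpectralBounds H l u) (k : ℕ) :
    ⟪(cgSeq H g k).r, (cgSeq H g k).p⟫ = ‖(cgSeq H g k).r‖ ^ 2 := by
  rw [(cgSeq_orthogonality hH k).2.2, real_inner_self_eq_norm_sq]

theorem cgSeq_p_ne_zero (hH : SpectralBounds H l u) {k : ℕ} (h : (cgSeq H g k).r ≠ 0) :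
    (cgSeq H g k).p ≠ 0 := by
  intro hp
  have := cgSeq_inner_r_p (g := g) hH k
  rw [hp, inner_zero_right] at this
  exact h (norm_eq_zero.1 (pow_eq_zero_iff two_ne_zero |>.1 this.symm))

theorem cgSeq_alpha_nonneg (hH : SpectralBounds H l u) (k : ℕ) : 0 ≤ (cgSeq H g k).alpha H :=
  div_nonneg real_inner_self_nonneg (hH.inner_nonneg _)

theorem cgSeq_alpha_mul (hH : SpectralBounds H l u) (k : ℕ) :
    (cgSeq H g k).alpha H * ⟪(cgSeq H g k).p, H (cgSeq H g k).p⟫ = ‖(cgSeq H g k).r‖ ^ 2 := by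
  by_cases hr : (cgSeq H g k).r = 0
  · rw [cgSeq_p_eq_zero hr, hr]; simp
  · rw [CGState.alpha, div_mul_cancel₀ _ (hH.inner_pos (cgSeq_p_ne_zero hH hr)).ne',
      real_inner_self_eq_norm_sq]

/-- The new direction is r + β p with β ≥ 0 and r orthogonal to all earlier directions, so
nonnegativity propagates. This sign drives both the growth of ‖s‖ and the decrease of the Euclidean
error. -/
theorem cgSeq_inner_p_nonneg (hH : SpectralBounds H l u) (i j : ℕ) :
    0 ≤ ⟪(cgSeq H g i).p, (cgSeq H g j).p⟫ := by
  have key : ∀ i d, 0 ≤ ⟪(cgSeq H g (i + d)).p, (cgSeq H g i).p⟫ := by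
    intro i d
    induction d with
    | zero => exact real_inner_self_nonneg
    | succ d ih =>
      rw [← add_assoc, cgSeq_succ_p, inner_add_left, real_inner_smul_left,
        (cgSeq_orthogonality hH (i + d + 1)).1 i (by omega), zero_add]
      exact mul_nonneg (div_nonneg real_inner_self_nonneg real_inner_self_nonneg) ih
  rcases le_total i j with h | h
  · obtain ⟨d, rfl⟩ := Nat.exists_eq_add_of_le h
    rw [real_inner_comm]; exact key i d
  · obtain ⟨d, rfl⟩ := Nat.exists_eq_add_of_le h
    exact key j d

/-- The increments of the iterates have nonnegative products with all the directions. -/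
theorem cgSeq_inner_s_sub_nonneg (hH : SpectralBounds H l u) {i j : ℕ} (hij : i ≤ j) (k : ℕ) :
    0 ≤ ⟪(cgSeq H g j).s - (cgSeq H g i).s, (cgSeq H g k).p⟫ := by
  induction j, hij using Nat.le_induction with
  | base => simp
  | succ j _ ih =>
    rw [cgSeq_succ_s, add_sub_right_comm, inner_add_left, real_inner_smul_left]
    exact add_nonneg ih (mul_nonneg (cgSeq_alpha_nonneg hH j) (cgSeq_inner_p_nonneg hH j k))

theorem cgSeq_inner_s_p_nonneg (hH : SpectralBounds H l u) (j k : ℕ) :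
    0 ≤ ⟪(cgSeq H g j).s, (cgSeq H g k).p⟫ := by
  simpa [cgSeq] using cgSeq_inner_s_sub_nonneg (g := g) hH (Nat.zero_le j) k

theorem cgSeq_inner_s_orthogonal (hH : SpectralBounds H l u) {j k : ℕ} (hjk : j ≤ k) :
    ⟪(cgSeq H g j).s, H (cgSeq H g k).p⟫ = 0 ∧ ⟪(cgSeq H g k).r, (cgSeq H g j).s⟫ = 0 := by
  induction j with
  | zero => simp [cgSeq]
  | succ j ih =>
    obtain ⟨h1, h2⟩ := ih (by omega)
    obtain ⟨h3, h4, -⟩ := cgSeq_orthogonality (g := g) hH k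
    rw [cgSeq_succ_s, inner_add_left, inner_add_right, real_inner_smul_left,
      real_inner_smul_right, h1, h2, h3 j (by omega), hH.symm', h4 j (by omega)]
    simp

theorem norm_add_smul_le_of_inner_nonneg {a b : E} (h : 0 ≤ ⟪a, b⟫) {c d : ℝ} (hc : 0 ≤ c)
    (hcd : c ≤ d) : ‖a + c • b‖ ≤ ‖a + d • b‖ := by
  refine (sq_le_sq₀ (norm_nonneg _) (norm_nonneg _)).1 ?_
  rw [norm_add_sq_real, norm_add_sq_real, real_inner_smul_right, real_inner_smul_right,
    norm_smul, norm_smul, mul_pow, mul_pow, Real.norm_eq_abs, Real.norm_eq_abs, sq_abs, sq_abs]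
  have h1 : c * ⟪a, b⟫ ≤ d * ⟪a, b⟫ := mul_le_mul_of_nonneg_right hcd h
  have h2 : c ^ 2 * ‖b‖ ^ 2 ≤ d ^ 2 * ‖b‖ ^ 2 := by gcongr
  linarith

theorem cgSeq_norm_s_mono (hH : SpectralBounds H l u) :
    Monotone fun k => ‖(cgSeq H g k).s‖ := by
  refine monotone_nat_of_le_succ fun k => ?_
  simpa [cgSeq_succ_s] using norm_add_smul_le_of_inner_nonneg
    (cgSeq_inner_s_p_nonneg (g := g) hH k k) le_rfl (cgSeq_alpha_nonneg hH k)

/-- By conjugacy, r = p − β p₋ satisfies ⟨r, Hr⟩ = ⟨p, Hp⟩ + β²⟨p₋, Hp₋⟩, hence ⟨p, Hp⟩ ≤ ⟨r, Hr⟩.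
The consequence is the step length bound α ≥ 1/u. -/
theorem cgSeq_inner_p_le (hH : SpectralBounds H l u) (k : ℕ) :
    ⟪(cgSeq H g k).p, H (cgSeq H g k).p⟫ ≤ u * ‖(cgSeq H g k).r‖ ^ 2 := by
  refine le_trans ?_ (hH.inner_le _)
  cases k with
  | zero => exact le_rfl
  | succ k =>
    set β := ⟪(cgSeq H g (k + 1)).r, (cgSeq H g (k + 1)).r⟫ / ⟪(cgSeq H g k).r, (cgSeq H g k).r⟫
      with hβ
    have e : (cgSeq H g (k + 1)).r = (cgSeq H g (k + 1)).p - β • (cgSeq H g k).p := by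
      rw [hβ, cgSeq_succ_p]; abel
    have h0 := (cgSeq_orthogonality (g := g) hH (k + 1)).2.1 k (by omega)
    have h1 := hH.symm' (cgSeq H g k).p (cgSeq H g (k + 1)).p
    rw [h0] at h1
    rw [e]
    simp only [map_sub, map_smul, inner_sub_left, inner_sub_right, real_inner_smul_left,
      real_inner_smul_right, h0, h1]
    nlinarith [mul_nonneg (sq_nonneg β) (hH.inner_nonneg (cgSeq H g k).p)]

theorem cgSeq_le_alpha (hH : SpectralBounds H l u) {k : ℕ} (h : (cgSeq H g k).r ≠ 0) :
    u⁻¹ ≤ (cgSeq H g k).alpha H := by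
  have hr : 0 < ‖(cgSeq H g k).r‖ ^ 2 := pow_pos (norm_pos_iff.2 h) 2
  rw [CGState.alpha, real_inner_self_eq_norm_sq,
    le_div_iff₀ (hH.inner_pos (cgSeq_p_ne_zero hH h)), inv_mul_le_iff₀ hH.upper_pos]
  exact cgSeq_inner_p_le hH k

/-- The energy of the error decreases geometrically. -/
theorem cgSeq_energy_le (hH : SpectralBounds H l u) {a : E} (ha : H a = -g) (k : ℕ) :
    ⟪a - (cgSeq H g k).s, H (a - (cgSeq H g k).s)⟫ ≤ (1 - l / u) ^ k * ⟪a, H a⟫ := by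
  induction k with
  | zero => simp [cgSeq]
  | succ k ih =>
    have hu := hH.upper_pos
    have hlu : 0 ≤ 1 - l / u := sub_nonneg.2 ((div_le_one hu).2 hH.le)
    rw [pow_succ', mul_assoc]
    refine le_trans ?_ (mul_le_mul_of_nonneg_left ih hlu)
    have hr : (cgSeq H g k).r = H (a - (cgSeq H g k).s) := by rw [cgSeq_r_eq, map_sub, ha]
    have hrp := cgSeq_inner_r_p (g := g) hH k
    have hα := cgSeq_alpha_mul (g := g) hH k
    have h3 : u⁻¹ * ‖(cgSeq H g k).r‖ ^ 2 ≤ (cgSeq H g k).alpha H * ‖(cgSeq H g k).r‖ ^ 2 := by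
      by_cases h : (cgSeq H g k).r = 0
      · simp [h]
      · exact mul_le_mul_of_nonneg_right (cgSeq_le_alpha hH h) (sq_nonneg _)
    have h0 := hH.lower_norm (a - (cgSeq H g k).s)
    have h1 := real_inner_le_norm (a - (cgSeq H g k).s) (H (a - (cgSeq H g k).s))
    -- With e the error and r = He, one pass lowers the energy by exactly α‖r‖², which is at least
    -- ‖He‖²/u ≥ (l/u)⟨e, He⟩.
    rw [cgSeq_succ_s, ← sub_sub]
    rw [hr] at hrp hα h3
    set e := a - (cgSeq H g k).s
    set α := (cgSeq H g k).alpha H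
    set p := (cgSeq H g k).p
    have hsym := hH.symm' p e
    rw [real_inner_comm] at hrp
    simp only [map_sub, map_smul, inner_sub_left, inner_sub_right, real_inner_smul_left,
      real_inner_smul_right, hα, ← hsym, hrp]
    have h2 : l * ⟪e, H e⟫ ≤ ‖H e‖ ^ 2 := by
      nlinarith [hH.pos, norm_nonneg e, norm_nonneg (H e),
        mul_le_mul_of_nonneg_right h0 (norm_nonneg (H e))]
    have h4 : l / u * ⟪e, H e⟫ ≤ u⁻¹ * ‖H e‖ ^ 2 := by
      rw [div_eq_inv_mul, mul_assoc]; gcongr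
    nlinarith

/-- Serves to let j → ∞ in `cgSeq_inner_s_sub_nonneg`; finite termination of CG is not needed. -/
theorem cgSeq_tendsto (hH : SpectralBounds H l u) {a : E} (ha : H a = -g) :
    Tendsto (fun k => (cgSeq H g k).s) atTop (𝓝 a) := by
  have hu := hH.upper_pos
  have hl := hH.pos
  have h1 : Tendsto (fun k : ℕ => l⁻¹ * ((1 - l / u) ^ k * ⟪a, H a⟫)) atTop (𝓝 0) := by
    have := tendsto_pow_atTop_nhds_zero_of_lt_one (r := 1 - l / u)
      (sub_nonneg.2 ((div_le_one hu).2 hH.le)) (sub_lt_self _ (div_pos hl hu))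
    simpa using (this.mul_const ⟪a, H a⟫).const_mul l⁻¹
  have h2 : Tendsto (fun k => ‖a - (cgSeq H g k).s‖ ^ 2) atTop (𝓝 0) := by
    refine squeeze_zero (fun k => sq_nonneg _) (fun k => ?_) h1
    rw [le_inv_mul_iff₀ hl]
    exact (hH.lower _).trans (cgSeq_energy_le hH ha k)
  have h3 : Tendsto (fun k => ‖a - (cgSeq H g k).s‖) atTop (𝓝 0) := by
    simpa using h2.sqrt
  rw [tendsto_iff_norm_sub_tendsto_zero]
  simpa [norm_sub_rev] using h3

/-- The direction of a pass makes a nonnegative product with the remaining error. -/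
theorem cgSeq_inner_error_nonneg (hH : SpectralBounds H l u) {a : E} (ha : H a = -g) (i k : ℕ) :
    0 ≤ ⟪a - (cgSeq H g i).s, (cgSeq H g k).p⟫ :=
  ge_of_tendsto (((cgSeq_tendsto hH ha).sub_const _).inner tendsto_const_nhds)
    ((eventually_ge_atTop i).mono fun _ hj => cgSeq_inner_s_sub_nonneg hH hj k)

/-- The Euclidean norm of the error decreases. -/
theorem cgSeq_error_sq_le (hH : SpectralBounds H l u) {a : E} (ha : H a = -g) (k : ℕ) :
    ‖(cgSeq H g (k + 1)).s - a‖ ^ 2 + ‖(cgSeq H g k).alpha H • (cgSeq H g k).p‖ ^ 2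
      ≤ ‖(cgSeq H g k).s - a‖ ^ 2 := by
  have h := mul_nonneg (cgSeq_alpha_nonneg (g := g) hH k)
    (cgSeq_inner_error_nonneg hH ha (k + 1) k)
  have e : a - (cgSeq H g k).s
      = (a - (cgSeq H g (k + 1)).s) + (cgSeq H g k).alpha H • (cgSeq H g k).p := by
    rw [cgSeq_succ_s]; abel
  rw [norm_sub_rev _ a, norm_sub_rev _ a, e, norm_add_sq_real, real_inner_smul_right]
  linarith

theorem cgSeq_error_antitone (hH : SpectralBounds H l u) {a : E} (ha : H a = -g) :
    Antitone fun k => ‖(cgSeq H g k).s - a‖ := by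
  refine antitone_nat_of_succ_le fun k => (sq_le_sq₀ (norm_nonneg _) (norm_nonneg _)).1 ?_
  linarith [cgSeq_error_sq_le (g := g) hH ha k,
    sq_nonneg ‖(cgSeq H g k).alpha H • (cgSeq H g k).p‖]

theorem cgSeq_le_norm_s (hH : SpectralBounds H l u) {k : ℕ} (hk : 0 < k) :
    u⁻¹ * ‖g‖ ≤ ‖(cgSeq H g k).s‖ := by
  refine le_trans ?_ (cgSeq_norm_s_mono hH hk)
  have e : (cgSeq H g (0 + 1)).s = (cgSeq H g 0).alpha H • (-g) := by
    rw [cgSeq_succ_s]; exact zero_add _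
  change _ ≤ ‖(cgSeq H g (0 + 1)).s‖
  rw [e, norm_smul, norm_neg, Real.norm_of_nonneg (cgSeq_alpha_nonneg hH 0)]
  by_cases hg : g = 0
  · simp [hg]
  · exact mul_le_mul_of_nonneg_right
      (cgSeq_le_alpha hH (by simpa [cgSeq] using hg)) (norm_nonneg _)

/-- The first iterate has length at least ‖g‖/u ≥ (l/u)‖a‖, and its square is subtracted from ‖a‖²
in the first pass. Later passes only decrease the error, so the factor does not depend on the
tolerance. -/
theorem cgSeq_error_le (hH : SpectralBounds H l u) {a : E} (ha : H a = -g) {k : ℕ} (hk : 0 < k) :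
    ‖(cgSeq H g k).s - a‖ ^ 2 ≤ (1 - (l / u) ^ 2) * ‖a‖ ^ 2 := by
  have h1 : ‖(cgSeq H g k).s - a‖ ^ 2 ≤ ‖(cgSeq H g 1).s - a‖ ^ 2 := by
    have := cgSeq_error_antitone hH ha (show 1 ≤ k from hk)
    gcongr
  have h2 := cgSeq_error_sq_le hH ha 0
  have e : (cgSeq H g (0 + 1)).s = (cgSeq H g 0).alpha H • (cgSeq H g 0).p := by
    rw [cgSeq_succ_s]; exact zero_add _
  rw [← e] at h2
  have h3 := cgSeq_le_norm_s (g := g) hH one_pos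
  have h4 : l / u * ‖a‖ ≤ u⁻¹ * ‖g‖ := by
    have := hH.lower_norm a
    rw [ha, norm_neg] at this
    rw [div_eq_inv_mul, mul_assoc]
    exact mul_le_mul_of_nonneg_left this (inv_nonneg.2 hH.upper_pos.le)
  have h5 : (l / u * ‖a‖) ^ 2 ≤ ‖(cgSeq H g 1).s‖ ^ 2 :=
    pow_le_pow_left₀ (mul_nonneg (div_nonneg hH.pos.le hH.upper_pos.le) (norm_nonneg _))
      (h4.trans h3) 2
  have e0 : ‖(cgSeq H g 0).s - a‖ = ‖a‖ := by simp [cgSeq]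
  rw [e0] at h2
  simp only [zero_add] at h2
  nlinarith

/-! ### Truncation at the trust region boundary and bounds for the resulting step. -/

/-- τ is the larger root of the quadratic equation ‖s + τp‖² = Δ². -/
theorem CGState.norm_add_tau_smul {Δ : ℝ} {S : CGState E} (hp : S.p ≠ 0) (hs : ‖S.s‖ ≤ Δ) :
    ‖S.s + S.tau Δ • S.p‖ = Δ := by
  have hΔ : 0 ≤ Δ := (norm_nonneg _).trans hs
  have hp' : 0 < ‖S.p‖ ^ 2 := pow_pos (norm_pos_iff.2 hp) 2
  have hD : 0 ≤ (⟪S.s, S.p⟫) ^ 2 + ‖S.p‖ ^ 2 * (Δ ^ 2 - ‖S.s‖ ^ 2) :=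
    add_nonneg (sq_nonneg _) (mul_nonneg hp'.le (sub_nonneg.2 (by gcongr)))
  have hsq := Real.sq_sqrt hD
  have hτ : S.tau Δ * ‖S.p‖ ^ 2 = -⟪S.s, S.p⟫ +
      √((⟪S.s, S.p⟫) ^ 2 + ‖S.p‖ ^ 2 * (Δ ^ 2 - ‖S.s‖ ^ 2)) := div_mul_cancel₀ _ hp'.ne'
  rw [← sq_eq_sq₀ (norm_nonneg _) hΔ, norm_add_sq_real, real_inner_smul_right, norm_smul,
    mul_pow, Real.norm_eq_abs, sq_abs]
  refine mul_left_cancel₀ hp'.ne' ?_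
  set q := √((⟪S.s, S.p⟫) ^ 2 + ‖S.p‖ ^ 2 * (Δ ^ 2 - ‖S.s‖ ^ 2))
  have hq : q = S.tau Δ * ‖S.p‖ ^ 2 + ⟪S.s, S.p⟫ := by rw [hτ]; ring
  rw [hq] at hsq
  linear_combination hsq

theorem CGState.tau_nonneg {Δ : ℝ} {S : CGState E} (hs : ‖S.s‖ ≤ Δ) : 0 ≤ S.tau Δ := by
  refine div_nonneg ?_ (sq_nonneg _)
  have h : (⟪S.s, S.p⟫) ^ 2 ≤ (⟪S.s, S.p⟫) ^ 2 + ‖S.p‖ ^ 2 * (Δ ^ 2 - ‖S.s‖ ^ 2) :=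
    le_add_of_nonneg_right (mul_nonneg (sq_nonneg _) (sub_nonneg.2 (by gcongr)))
  have := (le_abs_self _).trans (Real.abs_le_sqrt h)
  linarith

theorem CGOutput.eq_zero {Δ ξ : ℝ} {s : E} (hs : CGOutput H 0 Δ ξ s) : s = 0 := by
  have h0 : CGConverged H (0 : E) ξ 0 := by simp [CGConverged, cgSeq]
  obtain ⟨k, hk, h⟩ := hs
  rcases Nat.eq_zero_or_pos k with rfl | hpos
  · rcases h with h | h
    · exact h.2
    · exact absurd h0 h.1
  · exact absurd h0 (hk 0 hpos).1

/-- What the trust region method needs to know of a step produced by conjugate gradients. -/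
structure CGOutputBounds (H : E →L[ℝ] E) (g : E) (Δ ξ l u : ℝ) (s : E) : Prop where
  norm_le_radius : ‖s‖ ≤ Δ
  norm_le : l * ‖s‖ ≤ ‖g‖
  model_le : ⟪g, s⟫ + 1 / 2 * ⟪s, H s⟫ ≤ -(l / 2 * ‖s‖ ^ 2)
  le_norm : min Δ (u⁻¹ * ‖g‖) ≤ ‖s‖
  residual_le : ‖s‖ < Δ → ‖H s + g‖ ≤ ξ * ‖g‖
  error_le : ‖s‖ < Δ → ∀ a, H a = -g → ‖s - a‖ ^ 2 ≤ (1 - (l / u) ^ 2) * ‖a‖ ^ 2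

/-- With r = −g − Hs, the hypothesis reads ⟨g, s⟩ ≤ −⟨s, Hs⟩: the model has not started to increase
along the ray through s. Both bounds follow from ⟨s, Hs⟩ ≥ l‖s‖². -/
theorem SpectralBounds.model_le_of_inner_nonneg (hH : SpectralBounds H l u) {s : E}
    (h : 0 ≤ ⟪-g - H s, s⟫) :
    l * ‖s‖ ≤ ‖g‖ ∧ ⟪g, s⟫ + 1 / 2 * ⟪s, H s⟫ ≤ -(l / 2 * ‖s‖ ^ 2) := by
  rw [inner_sub_left, inner_neg_left, ← hH.symm] at h
  have h1 := hH.lower s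
  refine ⟨?_, by linarith⟩
  rcases (norm_nonneg s).eq_or_lt with h0 | h0
  · rw [← h0, mul_zero]; exact norm_nonneg _
  · have h2 := (neg_le_abs _).trans (abs_real_inner_le_norm g s)
    nlinarith

theorem CGOutput.bounds (hH : SpectralBounds H l u) {Δ ξ : ℝ} {s : E} (hg : g ≠ 0) (hΔ : 0 ≤ Δ)
    (hξ : 0 ≤ ξ ∧ ξ < 1) (hs : CGOutput H g Δ ξ s) : CGOutputBounds H g Δ ξ l u s := by
  obtain ⟨k, hk, h⟩ := hs
  have hin : ‖(cgSeq H g k).s‖ ≤ Δ := by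
    cases k with
    | zero => simpa [cgSeq] using hΔ
    | succ k => exact (hk k (by omega)).2
  rcases h with ⟨hc, rfl⟩ | ⟨hc, hout, rfl⟩
  -- The residual test cannot succeed in pass 0, because ξ < 1 and g ≠ 0; so at least one full step
  -- has been made.
  · have hk0 : 0 < k := by
      rcases Nat.eq_zero_or_pos k with rfl | hpos
      · exfalso
        have h1 : ‖g‖ ≤ ξ * ‖g‖ := by simpa [CGConverged, cgSeq] using hc
        nlinarith [norm_pos_iff.2 hg]
      · exact hpos
    have hm := hH.model_le_of_inner_nonneg (g := g) (s := (cgSeq H g k).s) (by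
      rw [← cgSeq_r_eq, (cgSeq_inner_s_orthogonal hH le_rfl).2])
    refine ⟨hin, hm.1, hm.2, (min_le_right _ _).trans (cgSeq_le_norm_s hH hk0), fun _ => ?_,
      fun _ a ha => cgSeq_error_le hH ha hk0⟩
    have e : H (cgSeq H g k).s + g = -(cgSeq H g k).r := by rw [cgSeq_r_eq]; abel
    rw [e, norm_neg]; exact hc
  · have hr : (cgSeq H g k).r ≠ 0 := by
      intro hr
      apply hc
      rw [CGConverged, hr, norm_zero]
      exact mul_nonneg hξ.1 (norm_nonneg _)
    have hp := cgSeq_p_ne_zero hH hr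
    have hτ0 := CGState.tau_nonneg hin
    have hn := CGState.norm_add_tau_smul hp hin
    have hsp := cgSeq_inner_s_p_nonneg (g := g) hH k k
    have hτα : (cgSeq H g k).tau Δ ≤ (cgSeq H g k).alpha H := by
      by_contra! hlt
      exact hout ((norm_add_smul_le_of_inner_nonneg hsp (cgSeq_alpha_nonneg hH k) hlt.le).trans
        hn.le)
    -- The residual at the boundary point satisfies ⟨r − τHp, s + τp⟩ = τ(α − τ)⟨p, Hp⟩ ≥ 0.
    have hm := hH.model_le_of_inner_nonneg (g := g)
      (s := (cgSeq H g k).s + (cgSeq H g k).tau Δ • (cgSeq H g k).p) (by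
        obtain ⟨h1, h2⟩ := cgSeq_inner_s_orthogonal (g := g) hH (le_refl k)
        have h3 := cgSeq_inner_r_p (g := g) hH k
        have h4 := cgSeq_alpha_mul (g := g) hH k
        have h5 := hH.inner_nonneg (cgSeq H g k).p
        rw [real_inner_comm] at h1
        rw [map_add, ← sub_sub, ← cgSeq_r_eq, map_smul]
        simp only [inner_sub_left, inner_add_right, real_inner_smul_left,
          real_inner_smul_right, h1, h2, h3, real_inner_comm (cgSeq H g k).p, ← h4]
        nlinarith [mul_nonneg hτ0 (mul_nonneg (sub_nonneg.2 hτα) h5)])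
    exact ⟨hn.le, hm.1, hm.2, (min_le_left _ _).trans hn.ge, fun h => absurd hn h.ne,
      fun h => absurd hn h.ne⟩

end ConjugateGradient

/-! ### Strongly convex objectives with Lipschitz Hessian. -/

section StronglyConvex

variable {E : Type*} [NormedAddCommGroup E] [InnerProductSpace ℝ E] [CompleteSpace E]

open scoped RealInnerProductSpace

/-- `f` is twice differentiable, its Hessian has spectrum in `[l, u]` and is Lipschitz with
constant `M`. -/
structure RegularObjective (f : E → ℝ) (l u M : ℝ) : Prop where
  hasGradientAt : ∀ w, HasGradientAt f (gradient f w) w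
  hasFDerivAt : ∀ w, HasFDerivAt (gradient f) (hessian f w) w
  bounds : ∀ w, SpectralBounds (hessian f w) l u
  lipschitz : ∀ v w, ‖hessian f v - hessian f w‖ ≤ M * ‖v - w‖
  nonneg : 0 ≤ M

namespace RegularObjective

variable {f : E → ℝ} {l u M : ℝ}

theorem pos (hf : RegularObjective f l u M) : 0 < l := (hf.bounds 0).pos

theorem upper_pos (hf : RegularObjective f l u M) : 0 < u := (hf.bounds 0).upper_pos

theorem continuous (hf : RegularObjective f l u M) : Continuous f :=
  continuous_iff_continuousAt.2 fun w => (hf.hasGradientAt w).continuousAt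

theorem gradient_taylor (hf : RegularObjective f l u M) (w s : E) :
    ‖gradient f (w + s) - gradient f w - hessian f w s‖ ≤ M * ‖s‖ ^ 2 := by
  have h := Convex.norm_image_sub_le_of_norm_hasFDerivWithin_le' (𝕜 := ℝ) (f := gradient f)
    (f' := hessian f) (φ := hessian f w) (C := M * ‖s‖) (s := Metric.closedBall w ‖s‖)
    (x := w) (y := w + s)
    (fun z _ => (hf.hasFDerivAt z).hasFDerivWithinAt)
    (fun z hz => (hf.lipschitz z w).trans
      (mul_le_mul_of_nonneg_left (mem_closedBall_iff_norm.1 hz) hf.nonneg))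
    (convex_closedBall w ‖s‖) (by simp) (by simp)
  rw [add_sub_cancel_left] at h
  calc _ ≤ _ := h
    _ = _ := by ring

theorem hasFDerivAt_model (hf : RegularObjective f l u M) (w s : E) :
    HasFDerivAt (fun s => f (w + s) - quadModel f w s)
      (innerSL ℝ (gradient f (w + s) - gradient f w - hessian f w s)) s := by
  have h1 : HasFDerivAt (fun s => f (w + s)) (innerSL ℝ (gradient f (w + s))) s := by
    have h := hasGradientAt_iff_hasFDerivAt.1 (hf.hasGradientAt (w + s))
    have h' : HasFDerivAt (fun s : E => w + s) (ContinuousLinearMap.id ℝ E) s :=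
      (hasFDerivAt_id s).const_add w
    exact h.comp s h'
  have h2 : HasFDerivAt (fun s => ⟪gradient f w, s⟫) (innerSL ℝ (gradient f w)) s :=
    (innerSL ℝ (gradient f w)).hasFDerivAt
  have h3 := ((hasFDerivAt_id (𝕜 := ℝ) s).inner ℝ (hessian f w).hasFDerivAt).const_mul (1 / 2)
  refine (h1.sub (h2.add h3)).congr_fderiv ?_
  ext d
  have := (hf.bounds w).symm d s
  have h' := (hf.bounds w).symm' d s
  simp
  rw [real_inner_comm d (hessian f w s)] at *
  linarith

theorem quadModel_taylor (hf : RegularObjective f l u M) (w s : E) :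
    |f (w + s) - f w - quadModel f w s| ≤ M * ‖s‖ ^ 3 := by
  have h := Convex.norm_image_sub_le_of_norm_hasFDerivWithin_le (𝕜 := ℝ)
    (f := fun s => f (w + s) - quadModel f w s)
    (f' := fun s => innerSL ℝ (gradient f (w + s) - gradient f w - hessian f w s))
    (C := M * ‖s‖ ^ 2) (s := Metric.closedBall 0 ‖s‖) (x := 0) (y := s)
    (fun z _ => (hf.hasFDerivAt_model w z).hasFDerivWithinAt)
    (fun z hz => by
      rw [innerSL_apply_norm]
      refine (hf.gradient_taylor w z).trans (mul_le_mul_of_nonneg_left ?_ hf.nonneg)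
      exact pow_le_pow_left₀ (norm_nonneg _) (mem_closedBall_zero_iff.1 hz) 2)
    (convex_closedBall 0 ‖s‖) (by simp) (by simp)
  have e : f (w + s) - quadModel f w s - (f (w + 0) - quadModel f w 0)
      = f (w + s) - f w - quadModel f w s := by
    simp [quadModel]; ring
  rw [e, sub_zero, Real.norm_eq_abs] at h
  calc _ ≤ _ := h
    _ = _ := by ring

theorem gradient_sub_le (hf : RegularObjective f l u M) (v w : E) :
    ‖gradient f v - gradient f w‖ ≤ u * ‖v - w‖ :=
  Convex.norm_image_sub_le_of_norm_hasFDerivWithin_le (𝕜 := ℝ) (s := Set.univ)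
    (fun z _ => (hf.hasFDerivAt z).hasFDerivWithinAt)
    (fun z _ => ContinuousLinearMap.opNorm_le_bound _ hf.upper_pos.le (hf.bounds z).upper)
    convex_univ (Set.mem_univ _) (Set.mem_univ _)

/-- Strong convexity. -/
theorem add_le (hf : RegularObjective f l u M) (w d : E) :
    f w + ⟪gradient f w, d⟫ + l / 2 * ‖d‖ ^ 2 ≤ f (w + d) := by
  -- Along the line w + td, the bound on the Hessian is integrated twice: first the slope minus t
  -- l‖d‖² is monotone, then f minus its quadratic minorant.
  have hline : ∀ t : ℝ, HasDerivAt (fun t : ℝ => w + t • d) d t := fun t => by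
    simpa using ((hasDerivAt_id t).smul_const d).const_add w
  have h1 : ∀ t : ℝ, HasDerivAt (fun t : ℝ => ⟪gradient f (w + t • d), d⟫ - t * (l * ‖d‖ ^ 2))
      (⟪hessian f (w + t • d) d, d⟫ - l * ‖d‖ ^ 2) t := by
    intro t
    have h := (hf.hasFDerivAt (w + t • d)).comp_hasDerivAt t (hline t)
    have h' := h.inner ℝ (hasDerivAt_const t d)
    have h'' := h'.sub ((hasDerivAt_id t).mul_const (l * ‖d‖ ^ 2))
    exact h''.congr_deriv (by simp)
  have m1 : Monotone fun t : ℝ => ⟪gradient f (w + t • d), d⟫ - t * (l * ‖d‖ ^ 2) := by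
    refine monotone_of_deriv_nonneg (fun t => (h1 t).differentiableAt) fun t => ?_
    rw [(h1 t).deriv, ← (hf.bounds _).symm]
    exact sub_nonneg.2 ((hf.bounds _).lower d)
  have h2 : ∀ t : ℝ, HasDerivAt
      (fun t : ℝ => f (w + t • d) - (t * ⟪gradient f w, d⟫ + t ^ 2 * (l / 2 * ‖d‖ ^ 2)))
      (⟪gradient f (w + t • d), d⟫ - (⟪gradient f w, d⟫ + t * (l * ‖d‖ ^ 2))) t := by
    intro t
    have h := (hasGradientAt_iff_hasFDerivAt.1 (hf.hasGradientAt (w + t • d))).comp_hasDerivAt t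
      (hline t)
    have h' := ((hasDerivAt_id t).mul_const ⟪gradient f w, d⟫).add
      ((hasDerivAt_pow 2 t).mul_const (l / 2 * ‖d‖ ^ 2))
    refine (h.sub h').congr_deriv ?_
    simp
    ring
  have m2 : MonotoneOn
      (fun t : ℝ => f (w + t • d) - (t * ⟪gradient f w, d⟫ + t ^ 2 * (l / 2 * ‖d‖ ^ 2)))
      (Set.Icc 0 1) := by
    refine monotoneOn_of_deriv_nonneg (convex_Icc 0 1)
      (fun t _ => (h2 t).continuousAt.continuousWithinAt)
      (fun t _ => (h2 t).differentiableAt.differentiableWithinAt) fun t ht => ?_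
    rw [interior_Icc] at ht
    rw [(h2 t).deriv]
    have := m1 ht.1.le
    simp only [zero_smul, add_zero, zero_mul, sub_zero] at this
    linarith
  have := m2 (Set.left_mem_Icc.2 zero_le_one) (Set.right_mem_Icc.2 zero_le_one) zero_le_one
  simp only [zero_smul, add_zero, one_smul, zero_mul, one_mul, one_pow, sub_zero, ne_eq,
    OfNat.ofNat_ne_zero, not_false_eq_true, zero_pow] at this
  linarith

theorem exists_minimizer [FiniteDimensional ℝ E] (hf : RegularObjective f l u M) :
    ∃ a, ∀ w, f a ≤ f w := by
  refine hf.continuous.exists_forall_le ?_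
  have hl := hf.pos
  have h1 : Tendsto (fun r : ℝ => f 0 + r * (l / 2 * r + -‖gradient f 0‖)) atTop atTop :=
    tendsto_atTop_add_const_left _ _ (tendsto_id.atTop_mul_atTop₀
      (tendsto_atTop_add_const_right _ _ (tendsto_id.const_mul_atTop (half_pos hl))))
  refine tendsto_atTop_mono (fun w => ?_) (h1.comp (tendsto_norm_cocompact_atTop (E := E)))
  have h2 := hf.add_le 0 w
  rw [zero_add] at h2
  have h3 := (neg_le_abs _).trans (abs_real_inner_le_norm (gradient f 0) w)
  simp only [Function.comp_apply]
  nlinarith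

theorem gradient_eq_zero_of_forall_le (hf : RegularObjective f l u M) {a : E}
    (ha : ∀ w, f a ≤ f w) : gradient f a = 0 := by
  have h : IsLocalMin f a := Eventually.of_forall ha
  have := h.hasFDerivAt_eq_zero (hasGradientAt_iff_hasFDerivAt.1 (hf.hasGradientAt a))
  exact (LinearIsometryEquiv.map_eq_zero_iff _).1 this

theorem add_sq_le (hf : RegularObjective f l u M) {a : E} (ha : gradient f a = 0) (w : E) :
    f a + l / 2 * ‖w - a‖ ^ 2 ≤ f w := by
  simpa [ha] using hf.add_le a (w - a)

theorem lt_of_ne (hf : RegularObjective f l u M) {a w : E} (ha : gradient f a = 0) (hw : w ≠ a) :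
    f a < f w :=
  lt_of_lt_of_le (lt_add_of_pos_right _ (mul_pos (half_pos hf.pos)
    (pow_pos (norm_pos_iff.2 (sub_ne_zero.2 hw)) 2))) (hf.add_sq_le ha w)

/-- The Polyak–Łojasiewicz inequality: the strong convexity minorant at w is at least f(w) −
‖∇f(w)‖²/(2l) everywhere, by completing the square. -/
theorem sub_le_gradient_sq (hf : RegularObjective f l u M) (a w : E) :
    2 * l * (f w - f a) ≤ ‖gradient f w‖ ^ 2 := by
  have h1 := hf.add_le w (a - w)
  rw [add_sub_cancel] at h1
  have h2 := (neg_le_abs _).trans (abs_real_inner_le_norm (gradient f w) (a - w))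
  nlinarith [sq_nonneg (l * ‖a - w‖ - ‖gradient f w‖), hf.pos]

theorem norm_sub_le (hf : RegularObjective f l u M) {a : E} (ha : gradient f a = 0) (w : E) :
    l * ‖w - a‖ ≤ ‖gradient f w‖ := by
  have h1 := hf.add_sq_le ha w
  have h2 := hf.sub_le_gradient_sq a w
  have hl := hf.pos
  refine (sq_le_sq₀ (by positivity) (norm_nonneg _)).1 ?_
  nlinarith

theorem norm_gradient_le (hf : RegularObjective f l u M) {a : E} (ha : gradient f a = 0) (w : E) :
    ‖gradient f w‖ ≤ u * ‖w - a‖ := by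
  simpa [ha] using hf.gradient_sub_le w a

/-- The error of the exact Newton step. -/
theorem newton_error_le (hf : RegularObjective f l u M) {a w b : E} (ha : gradient f a = 0)
    (hb : hessian f w b = -gradient f w) : l * ‖w + b - a‖ ≤ M * ‖w - a‖ ^ 2 := by
  have h1 := (hf.bounds w).lower_norm (w + b - a)
  have h2 := hf.gradient_taylor w (a - w)
  rw [add_sub_cancel, ha] at h2
  -- The Hessian maps the Newton error to the Taylor remainder of the gradient, since ∇f(a) = 0.
  have e : hessian f w (w + b - a) = 0 - gradient f w - hessian f w (a - w) := by
    rw [show w + b - a = b - (a - w) by abel, map_sub, hb]; abel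
  rw [e] at h1
  rw [norm_sub_rev w a]
  exact h1.trans h2

end RegularObjective

end StronglyConvex

/-! ### Trust region method: global convergence. -/

section TrustRegion

variable {E : Type*} [NormedAddCommGroup E] [InnerProductSpace ℝ E] [CompleteSpace E]

open scoped RealInnerProductSpace

theorem TRParams.Admissible.δ₂_pos {P : TRParams} (hP : P.Admissible) : 0 < P.δ₂ :=
  hP.δ₁_pos.trans hP.δ₁_lt_δ₂

section Ratio

variable {f : E → ℝ} {l u M η : ℝ} {w s : E}

/-- Short steps that achieve the model decrease have a large reduction ratio. -/
theorem RegularObjective.le_reductionRatio (hf : RegularObjective f l u M) (hs : s ≠ 0)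
    (hq : quadModel f w s ≤ -(l / 2 * ‖s‖ ^ 2)) (hη : M * ‖s‖ ≤ (1 - η) * (l / 2)) :
    η ≤ reductionRatio f w s := by
  have hs' : 0 < ‖s‖ ^ 2 := pow_pos (norm_pos_iff.2 hs) 2
  have hl := hf.pos
  have hq0 : quadModel f w s < 0 := lt_of_le_of_lt hq (neg_lt_zero.2 (by positivity))
  have hη1 : 0 ≤ 1 - η := by
    have := (mul_nonneg hf.nonneg (norm_nonneg s)).trans hη
    exact nonneg_of_mul_nonneg_left this (half_pos hl)
  rw [reductionRatio, le_div_iff_of_neg hq0]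
  have h1 := (abs_le.1 (hf.quadModel_taylor w s)).2
  have h2 : M * ‖s‖ ^ 3 ≤ (1 - η) * (l / 2 * ‖s‖ ^ 2) := by
    calc M * ‖s‖ ^ 3 = M * ‖s‖ * ‖s‖ ^ 2 := by ring
      _ ≤ (1 - η) * (l / 2) * ‖s‖ ^ 2 := by gcongr
      _ = _ := by ring
  nlinarith

theorem add_le_of_lt_reductionRatio (hl : 0 ≤ l) (hη : 0 < η)
    (hq : quadModel f w s ≤ -(l / 2 * ‖s‖ ^ 2)) (hρ : η < reductionRatio f w s) :
    f (w + s) + η * (l / 2 * ‖s‖ ^ 2) ≤ f w := by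
  have hq0 : quadModel f w s < 0 := by
    refine lt_of_le_of_ne (hq.trans (neg_nonpos.2 (by positivity))) fun h => ?_
    rw [reductionRatio, h, div_zero] at hρ
    exact hη.not_gt hρ
  rw [reductionRatio, lt_div_iff_of_neg hq0] at hρ
  nlinarith

end Ratio

namespace IsTRONRun

variable {f : E → ℝ} {l u M : ℝ} {P : TRParams} {ξ : ℕ → ℝ} {w : ℕ → E} {Δ : ℕ → ℝ} {s : ℕ → E}

theorem eq_of_lt (h : IsTRONRun f P ξ w Δ s) {t : ℕ}
    (ht : P.η₀ < reductionRatio f (w t) (s t)) : w (t + 1) = w t + s t := by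
  rw [h.update, if_pos ht]

theorem eq_of_le (h : IsTRONRun f P ξ w Δ s) {t : ℕ}
    (ht : reductionRatio f (w t) (s t) ≤ P.η₀) : w (t + 1) = w t := by
  rw [h.update, if_neg ht.not_gt]

/-- After a stationary point has been reached, the iterates are constant. -/
theorem eq_of_gradient_eq_zero (h : IsTRONRun f P ξ w Δ s) {t₀ : ℕ}
    (h₀ : gradient f (w t₀) = 0) {t : ℕ} (ht : t₀ ≤ t) : w t = w t₀ := by
  induction t, ht using Nat.le_induction with
  | base => rfl
  | succ t _ ih =>
    have hs := h.step t
    rw [ih, h₀] at hs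
    rw [h.update, hs.eq_zero, add_zero, ite_self, ih]

theorem bounds (h : IsTRONRun f P ξ w Δ s) (hf : RegularObjective f l u M)
    (hξ : ∀ t, 0 ≤ ξ t ∧ ξ t < 1) (hg : ∀ t, gradient f (w t) ≠ 0) {t : ℕ} (hΔ : 0 ≤ Δ t) :
    CGOutputBounds (hessian f (w t)) (gradient f (w t)) (Δ t) (ξ t) l u (s t) :=
  (h.step t).bounds (hf.bounds _) (hg t) hΔ (hξ t)

/-- As long as the method does not terminate, the radii are bounded away from zero. -/
theorem exists_radius_ge (h : IsTRONRun f P ξ w Δ s) (hf : RegularObjective f l u M)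
    (hP : P.Admissible) (hξ : ∀ t, 0 ≤ ξ t ∧ ξ t < 1) (hg : ∀ t, gradient f (w t) ≠ 0) :
    ∃ θ Δmin : ℝ, 0 < θ ∧ 0 < Δmin ∧ (∀ t, Δmin ≤ Δ t) ∧
      ∀ t, ‖s t‖ ≤ θ → P.η₂ ≤ reductionRatio f (w t) (s t) := by
  have hl := hf.pos
  have hM := hf.nonneg
  have hη := sub_pos.2 hP.η₂_lt_one
  have hδ := hP.δ₁_pos
  -- Below this length the cubic model error is at most the fraction 1 − η₂ of the model decrease; M
  -- + 1 avoids division by zero.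
  set θ := (1 - P.η₂) * (l / 2) / (M + 1) with hθ
  have hθ0 : 0 < θ := by positivity
  have hMθ : M * θ ≤ (1 - P.η₂) * (l / 2) := by
    have : (M + 1) * θ = (1 - P.η₂) * (l / 2) := by rw [hθ]; field_simp
    linarith
  have key : ∀ t, 0 < Δ t → ‖s t‖ ≤ θ → P.η₂ ≤ reductionRatio f (w t) (s t) := by
    intro t hΔ hst
    have hb := h.bounds hf hξ hg hΔ.le
    have hs0 : s t ≠ 0 := by
      have : 0 < min (Δ t) (u⁻¹ * ‖gradient f (w t)‖) :=
        lt_min hΔ (mul_pos (inv_pos.2 hf.upper_pos) (norm_pos_iff.2 (hg t)))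
      exact norm_pos_iff.1 (this.trans_le hb.le_norm)
    exact hf.le_reductionRatio hs0 hb.model_le
      ((mul_le_mul_of_nonneg_left hst hM).trans hMθ)
  set Δmin := min ‖gradient f (w 0)‖ (P.δ₁ * θ) with hΔmin
  have hΔmin0 : 0 < Δmin := lt_min (norm_pos_iff.2 (hg 0)) (by positivity)
  have hΔ : ∀ t, Δmin ≤ Δ t := by
    intro t
    induction t with
    | zero => rw [h.radius_zero]; exact min_le_left _ _
    | succ t ih =>
      have hpos := hΔmin0.trans_le ih
      have hb := h.bounds hf hξ hg hpos.le
      rcases le_or_gt P.η₂ (reductionRatio f (w t) (s t)) with h2 | h2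
      · exact ih.trans (h.radius_high t h2).1
      -- A radius shrinks only if ρ < η₂, hence only after a step longer than θ, and it then stays
      -- at least δ₁θ.
      have hst : θ ≤ ‖s t‖ := by
        by_contra! hlt
        exact h2.not_ge (key t hpos hlt.le)
      refine (min_le_right _ _).trans ?_
      rcases le_or_gt (reductionRatio f (w t) (s t)) P.η₁ with h1 | h1
      · refine le_trans ?_ (h.radius_low t h1).1
        exact mul_le_mul_of_nonneg_left (le_min hst (hst.trans hb.norm_le_radius)) hδ.le
      · refine le_trans ?_ (h.radius_mid t h1 h2).1
        exact mul_le_mul_of_nonneg_left (hst.trans hb.norm_le_radius) hδ.le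
  exact ⟨θ, Δmin, hθ0, hΔmin0, hΔ, fun t => key t (hΔmin0.trans_le (hΔ t))⟩

theorem antitone (h : IsTRONRun f P ξ w Δ s) (hf : RegularObjective f l u M)
    (hP : P.Admissible) (hξ : ∀ t, 0 ≤ ξ t ∧ ξ t < 1) (hg : ∀ t, gradient f (w t) ≠ 0)
    (hΔ : ∀ t, 0 ≤ Δ t) : Antitone fun t => f (w t) := by
  refine antitone_nat_of_succ_le fun t => ?_
  rcases lt_or_ge P.η₀ (reductionRatio f (w t) (s t)) with h1 | h1
  · have := add_le_of_lt_reductionRatio hf.pos.le hP.η₀_pos (h.bounds hf hξ hg (hΔ t)).model_le h1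
    rw [h.eq_of_lt h1]
    have h2 : 0 ≤ P.η₀ * (l / 2 * ‖s t‖ ^ 2) :=
      mul_nonneg hP.η₀_pos.le (mul_nonneg (half_pos hf.pos).le (sq_nonneg _))
    linarith
  · rw [h.eq_of_le h1]

/-- The gradients come arbitrarily close to zero. -/
theorem exists_gradient_lt (h : IsTRONRun f P ξ w Δ s) (hf : RegularObjective f l u M)
    (hP : P.Admissible) (hξ : ∀ t, 0 ≤ ξ t ∧ ξ t < 1) (hg : ∀ t, gradient f (w t) ≠ 0)
    {Δmin : ℝ} (hΔmin : 0 < Δmin) (hΔ : ∀ t, Δmin ≤ Δ t) {a : E} (ha : gradient f a = 0)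
    {ε : ℝ} (hε : 0 < ε) : ∃ t, ‖gradient f (w t)‖ < ε := by
  by_contra! hlarge
  have hu := hf.upper_pos
  have hl := hf.pos
  have hη := hP.η₀_pos
  have hmono := h.antitone hf hP hξ hg fun t => hΔmin.le.trans (hΔ t)
  have hlim : Tendsto (fun t => f (w t)) atTop (𝓝 (⨅ t, f (w t))) :=
    tendsto_atTop_ciInf hmono ⟨f a, by
      rintro _ ⟨t, rfl⟩
      exact le_trans (le_add_of_nonneg_right (by positivity)) (hf.add_sq_le ha (w t))⟩
  have hdiff : Tendsto (fun t => f (w t) - f (w (t + 1))) atTop (𝓝 0) := by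
    simpa using hlim.sub (hlim.comp (tendsto_add_atTop_nat 1))
  set m := min Δmin (u⁻¹ * ε) with hm
  have hm0 : 0 < m := lt_min hΔmin (by positivity)
  have hrej : ∀ᶠ t in atTop, reductionRatio f (w t) (s t) ≤ P.η₀ := by
    have hc : 0 < P.η₀ * (l / 2 * m ^ 2) := by positivity
    filter_upwards [hdiff.eventually (gt_mem_nhds hc)] with t ht
    by_contra! hacc
    have hb := h.bounds hf hξ hg (hΔmin.le.trans (hΔ t))
    have h1 := add_le_of_lt_reductionRatio hl.le hη hb.model_le hacc
    rw [← h.eq_of_lt hacc] at h1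
    have h2 : m ≤ ‖s t‖ := by
      refine le_trans (min_le_min (hΔ t) ?_) hb.le_norm
      exact mul_le_mul_of_nonneg_left (hlarge t) (inv_nonneg.2 hu.le)
    have h3 : P.η₀ * (l / 2 * m ^ 2) ≤ P.η₀ * (l / 2 * ‖s t‖ ^ 2) := by gcongr
    linarith
  obtain ⟨T, hT⟩ := eventually_atTop.1 hrej
  -- Rejected steps fall under the rule for ρ ≤ η₁, which shrinks the radius by the factor δ₂ each
  -- time.
  have hgeo : ∀ j, Δ (T + j) ≤ P.δ₂ ^ j * Δ T := by
    intro j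
    induction j with
    | zero => simp
    | succ j ih =>
      have h1 := (h.radius_low (T + j) ((hT _ (by omega)).trans hP.η₀_lt_η₁.le)).2
      rw [pow_succ', mul_assoc]
      exact h1.trans (mul_le_mul_of_nonneg_left ih hP.δ₂_pos.le)
  have hzero : Tendsto (fun j => P.δ₂ ^ j * Δ T) atTop (𝓝 0) := by
    simpa using (tendsto_pow_atTop_nhds_zero_of_lt_one hP.δ₂_pos.le hP.δ₂_lt_one).mul_const (Δ T)
  exact hΔmin.not_ge (ge_of_tendsto' hzero fun j => (hΔ (T + j)).trans (hgeo j))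

/-- A single small gradient suffices: it makes f(w_T) − f(a) small, monotonicity keeps it small, and
quadratic growth at a bounds the distance. -/
theorem tendsto (h : IsTRONRun f P ξ w Δ s) (hf : RegularObjective f l u M)
    (hP : P.Admissible) (hξ : ∀ t, 0 ≤ ξ t ∧ ξ t < 1) (hg : ∀ t, gradient f (w t) ≠ 0)
    {Δmin : ℝ} (hΔmin : 0 < Δmin) (hΔ : ∀ t, Δmin ≤ Δ t) {a : E} (ha : gradient f a = 0) :
    Tendsto w atTop (𝓝 a) := by
  have hl := hf.pos
  have hmono := h.antitone hf hP hξ hg fun t => hΔmin.le.trans (hΔ t)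
  rw [Metric.tendsto_atTop]
  intro ε hε
  obtain ⟨T, hT⟩ := h.exists_gradient_lt hf hP hξ hg hΔmin hΔ ha (mul_pos hl hε)
  refine ⟨T, fun t ht => ?_⟩
  have h1 := hf.sub_le_gradient_sq a (w T)
  have h2 := hf.add_sq_le ha (w t)
  have h3 : f (w t) ≤ f (w T) := hmono ht
  have h4 : ‖gradient f (w T)‖ ^ 2 < (l * ε) ^ 2 :=
    pow_lt_pow_left₀ hT (norm_nonneg _) two_ne_zero
  rw [dist_eq_norm]
  refine (sq_lt_sq₀ (norm_nonneg _) hε.le).1 ?_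
  have h5 : l ^ 2 * ‖w t - a‖ ^ 2 < l ^ 2 * ε ^ 2 := by nlinarith
  exact lt_of_mul_lt_mul_left h5 (sq_nonneg l)

/-- In the end the trust region is inactive and all steps are accepted. -/
theorem eventually_newton_step (h : IsTRONRun f P ξ w Δ s) (hf : RegularObjective f l u M)
    (hP : P.Admissible) (hξ : ∀ t, 0 ≤ ξ t ∧ ξ t < 1) (hg : ∀ t, gradient f (w t) ≠ 0)
    {a : E} (ha : gradient f a = 0) :
    Tendsto w atTop (𝓝 a) ∧ ∀ᶠ t in atTop, w (t + 1) = w t + s t ∧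
      ‖hessian f (w t) (s t) + gradient f (w t)‖ ≤ ξ t * ‖gradient f (w t)‖ ∧
      ∀ b, hessian f (w t) b = -gradient f (w t) →
        ‖s t - b‖ ^ 2 ≤ (1 - (l / u) ^ 2) * ‖b‖ ^ 2 := by
  obtain ⟨θ, Δmin, hθ, hΔmin, hΔ, hρ⟩ := h.exists_radius_ge hf hP hξ hg
  have hl := hf.pos
  have hw := h.tendsto hf hP hξ hg hΔmin hΔ ha
  refine ⟨hw, ?_⟩
  have hs : Tendsto s atTop (𝓝 0) := by
    have h1 : Tendsto (fun t => l⁻¹ * (u * ‖w t - a‖)) atTop (𝓝 0) := by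
      simpa using ((tendsto_iff_norm_sub_tendsto_zero.1 hw).const_mul u).const_mul l⁻¹
    refine squeeze_zero_norm (fun t => ?_) h1
    rw [le_inv_mul_iff₀ hl]
    exact (h.bounds hf hξ hg (hΔmin.le.trans (hΔ t))).norm_le.trans (hf.norm_gradient_le ha _)
  have hsmall : ∀ {c : ℝ}, 0 < c → ∀ᶠ t in atTop, ‖s t‖ < c := fun hc => by
    simpa using hs.eventually (Metric.ball_mem_nhds 0 hc)
  filter_upwards [hsmall hθ, hsmall hΔmin] with t h1 h2
  have hb := h.bounds hf hξ hg (hΔmin.le.trans (hΔ t))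
  have hin := h2.trans_le (hΔ t)
  exact ⟨h.eq_of_lt ((hP.η₀_lt_η₁.trans hP.η₁_lt_η₂).trans_le (hρ t h1.le)),
    hb.residual_le hin, hb.error_le hin⟩

/-! ### Local rates of convergence. -/

variable [FiniteDimensional ℝ E]

/-- With b the exact Newton step, the new error is (s − b) + (w + b − a). The first term is at most
c‖b‖ with c < 1, where ‖b‖ equals ‖w − a‖ up to the quadratically small second term. -/
theorem qLinearRate (hf : RegularObjective f l u M) {a : E} (ha : gradient f a = 0)
    (hw : Tendsto w atTop (𝓝 a))
    (hstep : ∀ᶠ t in atTop, w (t + 1) = w t + s t ∧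
      ∀ b, hessian f (w t) b = -gradient f (w t) →
        ‖s t - b‖ ^ 2 ≤ (1 - (l / u) ^ 2) * ‖b‖ ^ 2) : QLinearRate w a := by
  have hl := hf.pos
  have hu := hf.upper_pos
  have hM := hf.nonneg
  have hc1 : 1 - (l / u) ^ 2 < 1 := sub_lt_self _ (by positivity)
  set c := √(1 - (l / u) ^ 2) with hc
  have hc0 : 0 ≤ c := Real.sqrt_nonneg _
  have hclt : c < 1 := by
    rw [hc, Real.sqrt_lt' one_pos, one_pow]; exact hc1
  have hlim : Tendsto (fun t => c + 2 * (M / l * ‖w t - a‖)) atTop (𝓝 c) := by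
    simpa using (((tendsto_iff_norm_sub_tendsto_zero.1 hw).const_mul (M / l)).const_mul 2).const_add c
  -- The gap between c and the midpoint of c and 1 absorbs the Newton error.
  refine ⟨(c + 1) / 2, by linarith, ?_⟩
  filter_upwards [hstep, hlim.eventually (gt_mem_nhds (show c < (c + 1) / 2 by linarith))]
    with t ⟨h1, h2⟩ h3
  obtain ⟨b, hb⟩ := (hf.bounds (w t)).exists_apply_eq (-gradient f (w t))
  have hN : ‖w t + b - a‖ ≤ M / l * ‖w t - a‖ ^ 2 := by
    rw [div_mul_eq_mul_div, le_div_iff₀' hl]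
    exact hf.newton_error_le ha hb
  have hsb : ‖s t - b‖ ≤ c * ‖b‖ := by
    have := Real.sqrt_le_sqrt (h2 b hb)
    rwa [Real.sqrt_sq (norm_nonneg _), Real.sqrt_mul' _ (sq_nonneg _),
      Real.sqrt_sq (norm_nonneg _)] at this
  have hbn : ‖b‖ ≤ ‖w t + b - a‖ + ‖w t - a‖ := by
    have := norm_sub_le (w t + b - a) (w t - a)
    rwa [show w t + b - a - (w t - a) = b by abel] at this
  have hfin : ‖w (t + 1) - a‖ ≤ ‖s t - b‖ + ‖w t + b - a‖ := by
    have := norm_add_le (s t - b) (w t + b - a)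
    rwa [show s t - b + (w t + b - a) = w (t + 1) - a by rw [h1]; abel] at this
  have he := norm_nonneg (w t - a)
  have h4 : c * ‖b‖ ≤ c * ‖w t - a‖ + ‖w t + b - a‖ := by
    nlinarith [norm_nonneg (w t + b - a)]
  calc ‖w (t + 1) - a‖ ≤ (c + 2 * (M / l * ‖w t - a‖)) * ‖w t - a‖ := by
        rw [add_mul]; linarith [hN, hfin, hsb]
    _ ≤ (c + 1) / 2 * ‖w t - a‖ := by gcongr

theorem eventually_error_le (hf : RegularObjective f l u M) {a : E} (ha : gradient f a = 0)
    (hξ : ∀ t, 0 ≤ ξ t)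
    (hstep : ∀ᶠ t in atTop, w (t + 1) = w t + s t ∧
      ‖hessian f (w t) (s t) + gradient f (w t)‖ ≤ ξ t * ‖gradient f (w t)‖) :
    ∀ᶠ t in atTop, ‖w (t + 1) - a‖ ≤ (ξ t * u + M * ‖w t - a‖) / l * ‖w t - a‖ := by
  have hl := hf.pos
  filter_upwards [hstep] with t ⟨h1, h2⟩
  obtain ⟨b, hb⟩ := (hf.bounds (w t)).exists_apply_eq (-gradient f (w t))
  have hN := hf.newton_error_le ha hb
  have hsb : l * ‖s t - b‖ ≤ ξ t * (u * ‖w t - a‖) := by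
    refine ((hf.bounds (w t)).lower_norm _).trans ?_
    rw [map_sub, hb, sub_neg_eq_add]
    exact h2.trans (mul_le_mul_of_nonneg_left (hf.norm_gradient_le ha _) (hξ t))
  have hfin : ‖w (t + 1) - a‖ ≤ ‖s t - b‖ + ‖w t + b - a‖ := by
    have := norm_add_le (s t - b) (w t + b - a)
    rwa [show s t - b + (w t + b - a) = w (t + 1) - a by rw [h1]; abel] at this
  rw [div_mul_eq_mul_div, le_div_iff₀' hl]
  nlinarith

/-- Convergence of the trust region Newton method for a regular objective. -/
theorem convergence (h : IsTRONRun f P ξ w Δ s) (hf : RegularObjective f l u M)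
    (hP : P.Admissible) (hξ : ∀ t, 0 ≤ ξ t ∧ ξ t < 1) {a : E} (ha : gradient f a = 0) :
    Tendsto w atTop (𝓝 a) ∧ QLinearRate w a ∧
      (Tendsto ξ atTop (𝓝 0) → QSuperlinearRate w a) ∧
      (∀ κ : ℝ, 0 < κ → (∀ᶠ t in atTop, ξ t = κ * ‖gradient f (w t)‖) → QQuadraticRate w a) := by
  -- Finite termination is separate, because the lower bounds on steps and radii need nonzero
  -- gradients.
  by_cases hg : ∃ t, gradient f (w t) = 0
  · obtain ⟨T, hT⟩ := hg
    have hwT : w T = a := by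
      have h1 := hf.norm_sub_le ha (w T)
      rw [hT, norm_zero] at h1
      have h2 : ‖w T - a‖ ≤ 0 := nonpos_of_mul_nonpos_right h1 hf.pos
      exact sub_eq_zero.1 (norm_le_zero_iff.1 h2)
    have hw : ∀ᶠ t in atTop, w t = a := by
      filter_upwards [eventually_ge_atTop T] with t ht
      rw [h.eq_of_gradient_eq_zero hT ht, hwT]
    have hw' : ∀ᶠ t in atTop, ‖w (t + 1) - a‖ = 0 := by
      filter_upwards [(tendsto_add_atTop_nat 1).eventually hw] with t ht
      rw [ht, sub_self, norm_zero]
    refine ⟨tendsto_nhds_of_eventually_eq hw, ⟨0, one_pos, ?_⟩, fun _ ε hε => ?_,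
      fun κ _ _ => ⟨0, ?_⟩⟩
    · exact hw'.mono fun t ht => by rw [ht, zero_mul]
    · exact hw'.mono fun t ht => by rw [ht]; positivity
    · exact hw'.mono fun t ht => by rw [ht, zero_mul]
  push Not at hg
  obtain ⟨hw, hstep⟩ := h.eventually_newton_step hf hP hξ hg ha
  have hl := hf.pos
  have hu := hf.upper_pos
  have herr := eventually_error_le hf ha (fun t => (hξ t).1)
    (hstep.mono fun t ht => ⟨ht.1, ht.2.1⟩)
  refine ⟨hw, qLinearRate hf ha hw (hstep.mono fun t ht => ⟨ht.1, ht.2.2⟩), fun hξ0 ε hε => ?_,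
    fun κ hκ hξκ => ⟨(κ * u * u + M) / l, ?_⟩⟩
  · have hlim : Tendsto (fun t => (ξ t * u + M * ‖w t - a‖) / l) atTop (𝓝 0) := by
      simpa using ((hξ0.mul_const u).add
        ((tendsto_iff_norm_sub_tendsto_zero.1 hw).const_mul M)).div_const l
    filter_upwards [herr, hlim.eventually (gt_mem_nhds hε)] with t h1 h2
    exact h1.trans (mul_le_mul_of_nonneg_right h2.le (norm_nonneg _))
  · filter_upwards [herr, hξκ] with t h1 h2
    refine h1.trans ?_
    have h3 : ξ t ≤ κ * (u * ‖w t - a‖) := by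
      rw [h2]; exact mul_le_mul_of_nonneg_left (hf.norm_gradient_le ha _) hκ.le
    calc (ξ t * u + M * ‖w t - a‖) / l * ‖w t - a‖
        ≤ (κ * (u * ‖w t - a‖) * u + M * ‖w t - a‖) / l * ‖w t - a‖ := by gcongr
      _ = _ := by ring

end IsTRONRun

end TrustRegion

/-! ### Smoothness of the two losses. -/

section Losses

open scoped RealInnerProductSpace

/-- `ψ` has the first and second derivatives `ψ'` and `ψ''`, the latter nonnegative, bounded by `B`
and Lipschitz with constant `K`. -/
structure SmoothConvexLoss (ψ ψ' ψ'' : ℝ → ℝ) (B K : ℝ) : Prop where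
  hasDerivAt : ∀ a, HasDerivAt ψ (ψ' a) a
  hasDerivAt' : ∀ a, HasDerivAt ψ' (ψ'' a) a
  nonneg : ∀ a, 0 ≤ ψ'' a
  le : ∀ a, ψ'' a ≤ B
  lipschitz : ∀ a b, |ψ'' a - ψ'' b| ≤ K * |a - b|

theorem SmoothConvexLoss.bound_nonneg {ψ ψ' ψ'' : ℝ → ℝ} {B K : ℝ}
    (h : SmoothConvexLoss ψ ψ' ψ'' B K) : 0 ≤ B := (h.nonneg 0).trans (h.le 0)

theorem SmoothConvexLoss.lipschitz_nonneg {ψ ψ' ψ'' : ℝ → ℝ} {B K : ℝ}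
    (h : SmoothConvexLoss ψ ψ' ψ'' B K) : 0 ≤ K := by
  simpa using (abs_nonneg _).trans (h.lipschitz 1 0)

/-- The smooth Hinge loss built from functions `Φ` and `φ` with `Φ' = k` and `φ' v = -v k v`. -/
theorem smoothConvexLoss_smoothHinge {Φ φ k : ℝ → ℝ} {B K σ : ℝ} (hσ : 0 < σ)
    (hΦ : ∀ v, HasDerivAt Φ (k v) v) (hφ : ∀ v, HasDerivAt φ (-(v * k v)) v)
    (hk : ∀ v, 0 ≤ k v) (hB : ∀ v, k v ≤ B) (hK : ∀ a b, |k a - k b| ≤ K * |a - b|) :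
    SmoothConvexLoss (fun α => Φ ((1 - α) / σ) * (1 - α) + φ ((1 - α) / σ) * σ)
      (fun α => -Φ ((1 - α) / σ)) (fun α => k ((1 - α) / σ) / σ) (B / σ) (K / σ / σ) := by
  have h1 : ∀ α : ℝ, HasDerivAt (fun α : ℝ => 1 - α) (-1) α := fun α =>
    (hasDerivAt_id α).const_sub 1
  have hv : ∀ α : ℝ, HasDerivAt (fun α : ℝ => (1 - α) / σ) (-1 / σ) α := fun α =>
    (h1 α).div_const σ
  have hΦv : ∀ α, HasDerivAt (fun α => Φ ((1 - α) / σ)) (k ((1 - α) / σ) * (-1 / σ)) α :=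
    fun α => (hΦ _).comp α (hv α)
  have hφv : ∀ α, HasDerivAt (fun α => φ ((1 - α) / σ))
      (-((1 - α) / σ * k ((1 - α) / σ)) * (-1 / σ)) α := fun α => (hφ _).comp α (hv α)
  refine ⟨fun α => ?_, fun α => ?_, fun α => div_nonneg (hk _) hσ.le,
    fun α => div_le_div_of_nonneg_right (hB _) hσ.le, fun a b => ?_⟩
  -- Since 1 − α = σv, the terms with k(v) from Φ′ and φ′ cancel, leaving −Φ(v).
  · refine (((hΦv α).mul (h1 α)).add ((hφv α).mul_const σ)).congr_deriv ?_
    field_simp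
    ring
  · refine (hΦv α).neg.congr_deriv ?_
    ring
  · rw [← sub_div, abs_div, abs_of_pos hσ, div_mul_eq_mul_div,
      div_le_div_iff_of_pos_right hσ]
    refine (hK _ _).trans_eq ?_
    rw [← sub_div, abs_div, abs_of_pos hσ, sub_sub_sub_cancel_left, abs_sub_comm]
    ring

theorem abs_sub_le_of_hasDerivAt {k k' : ℝ → ℝ} {K : ℝ} (h : ∀ v, HasDerivAt k (k' v) v)
    (hK : ∀ v, |k' v| ≤ K) (a b : ℝ) : |k a - k b| ≤ K * |a - b| :=
  Convex.norm_image_sub_le_of_norm_hasDerivWithin_le (s := Set.univ)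
    (fun v _ => (h v).hasDerivWithinAt) (fun v _ => hK v) convex_univ
    (Set.mem_univ b) (Set.mem_univ a)

theorem gaussianPDFReal_zero_one (v : ℝ) :
    gaussianPDFReal 0 1 v = (√(2 * Real.pi))⁻¹ * Real.exp (-(v ^ 2 / 2)) := by
  simp [gaussianPDFReal, neg_div]

theorem hasDerivAt_gaussianPDFReal_zero_one (v : ℝ) :
    HasDerivAt (gaussianPDFReal 0 1) (-(v * gaussianPDFReal 0 1 v)) v := by
  have h : HasDerivAt (fun v : ℝ => (√(2 * Real.pi))⁻¹ * Real.exp (-(v ^ 2 / 2)))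
      ((√(2 * Real.pi))⁻¹ * (Real.exp (-(v ^ 2 / 2)) * -(2 * v / 2))) v := by
    have h1 := ((hasDerivAt_pow 2 v).div_const 2).neg
    simpa using h1.exp.const_mul (√(2 * Real.pi))⁻¹
  rw [show gaussianPDFReal 0 1 = _ from funext gaussianPDFReal_zero_one]
  refine h.congr_deriv ?_
  ring

theorem gaussianPDFReal_zero_one_le (v : ℝ) : gaussianPDFReal 0 1 v ≤ (√(2 * Real.pi))⁻¹ := by
  rw [gaussianPDFReal_zero_one]
  exact mul_le_of_le_one_right (by positivity)
    (Real.exp_le_one_iff.2 (neg_nonpos.2 (by positivity)))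

theorem abs_mul_gaussianPDFReal_zero_one_le (v : ℝ) :
    |-(v * gaussianPDFReal 0 1 v)| ≤ (√(2 * Real.pi))⁻¹ := by
  rw [abs_neg, abs_mul, abs_of_nonneg (gaussianPDFReal_nonneg _ _ _), gaussianPDFReal_zero_one,
    mul_left_comm]
  refine mul_le_of_le_one_right (by positivity) ?_
  rw [Real.exp_neg, ← div_eq_mul_inv, div_le_one (Real.exp_pos _)]
  -- |v| ≤ 1 + v²/2 ≤ exp(v²/2).
  have := Real.add_one_le_exp (v ^ 2 / 2)
  nlinarith [sq_abs v, sq_nonneg (|v| - 1)]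

/-- Writing the distribution function as its value at 0 plus an integral from 0 to v makes the
fundamental theorem of calculus applicable. -/
theorem hasDerivAt_cdf_gaussianReal_zero_one (v : ℝ) :
    HasDerivAt (cdf (gaussianReal 0 1)) (gaussianPDFReal 0 1 v) v := by
  have hint := integrable_gaussianPDFReal 0 1
  have hcont : Continuous (gaussianPDFReal 0 1) :=
    continuous_iff_continuousAt.2 fun v => (hasDerivAt_gaussianPDFReal_zero_one v).continuousAt
  have hcdf : ∀ v, cdf (gaussianReal 0 1) v = ∫ x in Set.Iic v, gaussianPDFReal 0 1 x := by
    intro v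
    rw [cdf_eq_real, MeasureTheory.measureReal_def,
      gaussianReal_apply_eq_integral 0 one_ne_zero, ENNReal.toReal_ofReal]
    exact MeasureTheory.integral_nonneg fun x => gaussianPDFReal_nonneg _ _ _
  have heq : ⇑(cdf (gaussianReal 0 1)) = fun v =>
      cdf (gaussianReal 0 1) 0 + ∫ x in (0 : ℝ)..v, gaussianPDFReal 0 1 x := by
    funext v
    rw [← intervalIntegral.integral_Iic_sub_Iic hint.integrableOn hint.integrableOn, ← hcdf,
      ← hcdf]
    ring
  rw [heq]
  exact (intervalIntegral.integral_hasDerivAt_right hint.intervalIntegrable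
    (hcont.stronglyMeasurableAtFilter _ _) hcont.continuousAt).const_add _

theorem smoothConvexLoss_psiG {σ : ℝ} (hσ : 0 < σ) :
    ∃ ψ' ψ'' B K, SmoothConvexLoss (psiG σ) ψ' ψ'' B K :=
  ⟨_, _, _, _, smoothConvexLoss_smoothHinge hσ hasDerivAt_cdf_gaussianReal_zero_one
    hasDerivAt_gaussianPDFReal_zero_one (gaussianPDFReal_nonneg 0 1) gaussianPDFReal_zero_one_le
    (abs_sub_le_of_hasDerivAt hasDerivAt_gaussianPDFReal_zero_one
      abs_mul_gaussianPDFReal_zero_one_le)⟩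

theorem hasDerivAt_sqrt_one_add_sq (v : ℝ) :
    HasDerivAt (fun v : ℝ => √(1 + v ^ 2)) (v / √(1 + v ^ 2)) v := by
  have h := ((hasDerivAt_pow 2 v).const_add 1).sqrt (by positivity)
  refine h.congr_deriv ?_
  field_simp
  simp

theorem hasDerivAt_PhiM (v : ℝ) : HasDerivAt PhiM (1 / (2 * √(1 + v ^ 2) ^ 3)) v := by
  have hpos : 0 < √(1 + v ^ 2) := Real.sqrt_pos.2 (by positivity)
  have hsq : √(1 + v ^ 2) ^ 2 = 1 + v ^ 2 := Real.sq_sqrt (by positivity)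
  have h := (((hasDerivAt_id v).div (hasDerivAt_sqrt_one_add_sq v) hpos.ne').const_add 1).div_const 2
  refine h.congr_deriv ?_
  simp only [id]
  field_simp
  rw [hsq]
  ring

theorem hasDerivAt_phiM (v : ℝ) : HasDerivAt phiM (-(v * (1 / (2 * √(1 + v ^ 2) ^ 3)))) v := by
  have hpos : 0 < √(1 + v ^ 2) := Real.sqrt_pos.2 (by positivity)
  have h := (hasDerivAt_const v (1 : ℝ)).div ((hasDerivAt_sqrt_one_add_sq v).const_mul 2)
    (mul_pos two_pos hpos).ne'
  refine h.congr_deriv ?_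
  field_simp
  ring

theorem one_le_sqrt_one_add_sq (v : ℝ) : 1 ≤ √(1 + v ^ 2) :=
  Real.one_le_sqrt.2 (le_add_of_nonneg_right (sq_nonneg v))

theorem abs_one_div_sqrt_cube_sub_le (a b : ℝ) :
    |1 / (2 * √(1 + a ^ 2) ^ 3) - 1 / (2 * √(1 + b ^ 2) ^ 3)| ≤ 3 / 2 * |a - b| := by
  refine abs_sub_le_of_hasDerivAt (k := fun v => 1 / (2 * √(1 + v ^ 2) ^ 3))
    (k' := fun v => -(3 / 2 * (v / √(1 + v ^ 2) ^ 5))) (fun v => ?_) (fun v => ?_) a b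
  · have hpos : 0 < √(1 + v ^ 2) := Real.sqrt_pos.2 (by positivity)
    have h := (hasDerivAt_const v (1 : ℝ)).div (((hasDerivAt_sqrt_one_add_sq v).pow 3).const_mul 2)
      (mul_pos two_pos (pow_pos hpos 3)).ne'
    refine h.congr_deriv ?_
    simp only [Pi.pow_apply]
    field_simp
    ring
  · have h1 := one_le_sqrt_one_add_sq v
    have hv : |v| ≤ √(1 + v ^ 2) := Real.abs_le_sqrt (by linarith)
    have h5 : √(1 + v ^ 2) ≤ √(1 + v ^ 2) ^ 5 := le_self_pow₀ h1 (by norm_num)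
    have hpos : 0 < √(1 + v ^ 2) ^ 5 := by positivity
    rw [abs_neg, abs_mul, abs_div v, abs_of_pos hpos, abs_of_pos (by norm_num : (0 : ℝ) < 3 / 2)]
    exact mul_le_of_le_one_right (by norm_num) ((div_le_one hpos).2 (hv.trans h5))

theorem smoothConvexLoss_psiM {σ : ℝ} (hσ : 0 < σ) :
    ∃ ψ' ψ'' B K, SmoothConvexLoss (psiM σ) ψ' ψ'' B K := by
  refine ⟨_, _, 1 / 2 / σ, _, smoothConvexLoss_smoothHinge hσ hasDerivAt_PhiM hasDerivAt_phiM
    (fun v => by positivity) (fun v => ?_) abs_one_div_sqrt_cube_sub_le⟩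
  have h1 : 1 ≤ √(1 + v ^ 2) ^ 3 := one_le_pow₀ (one_le_sqrt_one_add_sq v)
  exact one_div_le_one_div_of_le two_pos (by linarith)

/-! ### Regularity of the regularized empirical risk. -/

section Objective

variable {p n : ℕ} {ψ ψ' ψ'' : ℝ → ℝ} {B K lam : ℝ} {x : Fin n → EuclideanSpace ℝ (Fin p)}
  {y : Fin n → ℝ}

/-- The gradient of the regularized empirical risk, for a loss with derivative `ψ'`. -/
noncomputable def svmGradient (ψ' : ℝ → ℝ) (lam : ℝ) (x : Fin n → EuclideanSpace ℝ (Fin p)) (y : Fin n → ℝ)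
    (w : EuclideanSpace ℝ (Fin p)) : EuclideanSpace ℝ (Fin p) :=
  lam • w + (1 / (n : ℝ)) • ∑ i, (ψ' (y i * ⟪w, x i⟫) * y i) • x i

/-- The Hessian of the regularized empirical risk, for a loss with second derivative `ψ''`. -/
noncomputable def svmHessian (ψ'' : ℝ → ℝ) (lam : ℝ) (x : Fin n → EuclideanSpace ℝ (Fin p))
    (y : Fin n → ℝ) (w : EuclideanSpace ℝ (Fin p)) :
    EuclideanSpace ℝ (Fin p) →L[ℝ] EuclideanSpace ℝ (Fin p) :=
  lam • ContinuousLinearMap.id ℝ _ + (1 / (n : ℝ)) • ∑ i, (ψ'' (y i * ⟪w, x i⟫) * y i ^ 2) •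
    (innerSL ℝ (x i)).smulRight (x i)

theorem hasFDerivAt_margin (i : Fin n) (w : EuclideanSpace ℝ (Fin p)) :
    HasFDerivAt (fun w => y i * ⟪w, x i⟫) (y i • innerSL ℝ (x i)) w := by
  have h := (innerSL ℝ (x i)).hasFDerivAt (x := w)
  simpa [real_inner_comm] using h.const_mul (y i)

theorem SmoothConvexLoss.hasGradientAt_svmObjective (h : SmoothConvexLoss ψ ψ' ψ'' B K)
    (w : EuclideanSpace ℝ (Fin p)) :
    HasGradientAt (svmObjective ψ lam x y) (svmGradient ψ' lam x y w) w := by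
  rw [hasGradientAt_iff_hasFDerivAt]
  have h1 : HasFDerivAt (fun w => ∑ i, ψ (y i * ⟪w, x i⟫))
      (∑ i, ψ' (y i * ⟪w, x i⟫) • (y i • innerSL ℝ (x i))) w :=
    HasFDerivAt.fun_sum fun i _ => (h.hasDerivAt _).comp_hasFDerivAt w (hasFDerivAt_margin i w)
  have h2 := (hasStrictFDerivAt_norm_sq w).hasFDerivAt.const_mul (1 / 2 * lam)
  refine (h2.add (h1.const_mul (1 / (n : ℝ)))).congr_fderiv ?_
  ext d
  simp [svmGradient, mul_assoc]
  ring

theorem SmoothConvexLoss.hasFDerivAt_svmGradient (h : SmoothConvexLoss ψ ψ' ψ'' B K)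
    (w : EuclideanSpace ℝ (Fin p)) :
    HasFDerivAt (svmGradient ψ' lam x y) (svmHessian ψ'' lam x y w) w := by
  have h1 : HasFDerivAt (fun w => ∑ i, (ψ' (y i * ⟪w, x i⟫) * y i) • x i)
      (∑ i, (ψ'' (y i * ⟪w, x i⟫) * y i ^ 2) • (innerSL ℝ (x i)).smulRight (x i)) w := by
    refine HasFDerivAt.fun_sum fun i _ => ?_
    have h2 := (((h.hasDerivAt' _).comp_hasFDerivAt w (hasFDerivAt_margin (x := x) (y := y) i w)
      ).mul_const (y i)).smul_const (x i)
    refine h2.congr_fderiv ?_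
    ext d
    simp
    ring
  exact ((hasFDerivAt_id w).const_smul lam).add (h1.const_smul (1 / (n : ℝ)))

theorem inner_svmHessian (w a b : EuclideanSpace ℝ (Fin p)) :
    ⟪a, svmHessian ψ'' lam x y w b⟫ = lam * ⟪a, b⟫ +
      1 / (n : ℝ) * ∑ i, ψ'' (y i * ⟪w, x i⟫) * y i ^ 2 * (⟪x i, b⟫ * ⟪x i, a⟫) := by
  simp [svmHessian, inner_add_right, inner_sum, real_inner_smul_right, real_inner_comm, mul_assoc]

/-- The loss contributes nonnegative multiples of the rank-one forms ⟨xᵢ, ·⟩², so the regularizer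
alone gives the lower bound; the upper bound adds the operator norms. -/
theorem SmoothConvexLoss.spectralBounds_svmHessian (h : SmoothConvexLoss ψ ψ' ψ'' B K)
    (hlam : 0 < lam) (w : EuclideanSpace ℝ (Fin p)) :
    SpectralBounds (svmHessian ψ'' lam x y w) lam
      (lam + 1 / (n : ℝ) * ∑ i, B * y i ^ 2 * (‖x i‖ * ‖x i‖)) := by
  have hB := h.bound_nonneg
  refine ⟨fun a b => ?_, hlam, ?_, fun a => ?_, fun a => ?_⟩
  · rw [real_inner_comm b (svmHessian _ _ _ _ _ a), inner_svmHessian, inner_svmHessian, real_inner_comm]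
    simp only [mul_comm]
  · refine le_add_of_nonneg_right (mul_nonneg (by positivity) (Finset.sum_nonneg fun i _ => ?_))
    positivity
  · rw [inner_svmHessian, real_inner_self_eq_norm_sq]
    refine le_add_of_nonneg_right (mul_nonneg (by positivity) (Finset.sum_nonneg fun i _ => ?_))
    exact mul_nonneg (mul_nonneg (h.nonneg _) (sq_nonneg _)) (mul_self_nonneg _)
  · refine (ContinuousLinearMap.le_opNorm _ a).trans
      (mul_le_mul_of_nonneg_right ?_ (norm_nonneg a))
    refine (norm_add_le _ _).trans (add_le_add ?_ ?_)
    · rw [norm_smul, Real.norm_of_nonneg hlam.le]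
      exact mul_le_of_le_one_right hlam.le ContinuousLinearMap.norm_id_le
    · rw [norm_smul, Real.norm_of_nonneg (by positivity)]
      refine mul_le_mul_of_nonneg_left ((norm_sum_le _ _).trans
        (Finset.sum_le_sum fun i _ => ?_)) (by positivity)
      rw [norm_smul, ContinuousLinearMap.norm_smulRight_apply, innerSL_apply_norm,
        Real.norm_of_nonneg (mul_nonneg (h.nonneg _) (sq_nonneg _))]
      have := h.le (y i * ⟪w, x i⟫)
      gcongr

theorem SmoothConvexLoss.norm_svmHessian_sub_le (h : SmoothConvexLoss ψ ψ' ψ'' B K)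
    (v w : EuclideanSpace ℝ (Fin p)) :
    ‖svmHessian ψ'' lam x y v - svmHessian ψ'' lam x y w‖ ≤
      1 / (n : ℝ) * (∑ i, K * |y i| * ‖x i‖ * y i ^ 2 * (‖x i‖ * ‖x i‖)) * ‖v - w‖ := by
  have hK := h.lipschitz_nonneg
  have e : svmHessian ψ'' lam x y v - svmHessian ψ'' lam x y w = (1 / (n : ℝ)) •
      ∑ i, ((ψ'' (y i * ⟪v, x i⟫) - ψ'' (y i * ⟪w, x i⟫)) * y i ^ 2) •
        (innerSL ℝ (x i)).smulRight (x i) := by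
    simp only [svmHessian, sub_mul, sub_smul, Finset.sum_sub_distrib]
    module
  rw [e, norm_smul, Real.norm_of_nonneg (by positivity), mul_assoc, Finset.sum_mul]
  refine mul_le_mul_of_nonneg_left ((norm_sum_le _ _).trans
    (Finset.sum_le_sum fun i _ => ?_)) (by positivity)
  rw [norm_smul, ContinuousLinearMap.norm_smulRight_apply,
    innerSL_apply_norm, norm_mul, Real.norm_of_nonneg (sq_nonneg (y i)), Real.norm_eq_abs]
  have h1 := h.lipschitz (y i * ⟪v, x i⟫) (y i * ⟪w, x i⟫)
  rw [← mul_sub, ← inner_sub_left, abs_mul] at h1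
  have h2 := abs_real_inner_le_norm (v - w) (x i)
  calc _ ≤ K * (|y i| * (‖v - w‖ * ‖x i‖)) * y i ^ 2 * (‖x i‖ * ‖x i‖) := by
        gcongr
        exact h1.trans (by gcongr)
    _ = _ := by ring

theorem SmoothConvexLoss.regularObjective_svmObjective (h : SmoothConvexLoss ψ ψ' ψ'' B K)
    (hlam : 0 < lam) : ∃ u M, RegularObjective (svmObjective ψ lam x y) lam u M := by
  have hgrad : gradient (svmObjective ψ lam x y) = svmGradient ψ' lam x y :=
    gradient_eq h.hasGradientAt_svmObjective
  have hhess : hessian (svmObjective ψ lam x y) = svmHessian ψ'' lam x y := by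
    funext w
    rw [hessian, hgrad]
    exact (h.hasFDerivAt_svmGradient w).fderiv
  have hK := h.lipschitz_nonneg
  refine ⟨lam + 1 / (n : ℝ) * ∑ i, B * y i ^ 2 * (‖x i‖ * ‖x i‖),
    1 / (n : ℝ) * ∑ i, K * |y i| * ‖x i‖ * y i ^ 2 * (‖x i‖ * ‖x i‖),
    fun w => ?_, fun w => ?_, fun w => ?_, fun v w => ?_, ?_⟩
  · rw [hgrad]; exact h.hasGradientAt_svmObjective w
  · rw [hgrad, hhess]; exact h.hasFDerivAt_svmGradient w
  · rw [hhess]; exact h.spectralBounds_svmHessian hlam w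
  · rw [hhess]; exact h.norm_svmHessian_sub_le v w
  · exact mul_nonneg (by positivity) (Finset.sum_nonneg fun i _ => by positivity)

end Objective

end Losses

/-! ### The convergence theorem for smooth Hinge losses. -/

theorem theorem4 {p n : ℕ} (hn : 0 < n) (x : Fin n → EuclideanSpace ℝ (Fin p)) (y : Fin n → ℝ)
    (hy : ∀ i, y i = 1 ∨ y i = -1) (lam σ : ℝ) (hlam : 0 < lam) (hσ : 0 < σ)
    (ψ : ℝ → ℝ) (hψ : ψ = psiG σ ∨ ψ = psiM σ) :
    ∃ wstar : EuclideanSpace ℝ (Fin p),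
      (∀ w, w ≠ wstar → svmObjective ψ lam x y wstar < svmObjective ψ lam x y w) ∧
      ∀ (P : TRParams), P.Admissible →
      ∀ (ξ : ℕ → ℝ), (∀ t, 0 ≤ ξ t ∧ ξ t < 1) →
      ∀ (w : ℕ → EuclideanSpace ℝ (Fin p)) (Δ : ℕ → ℝ) (s : ℕ → EuclideanSpace ℝ (Fin p)),
        IsTRONRun (svmObjective ψ lam x y) P ξ w Δ s →
          Tendsto w atTop (𝓝 wstar) ∧
          QLinearRate w wstar ∧
          (Tendsto ξ atTop (𝓝 0) → QSuperlinearRate w wstar) ∧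
          (∀ κ : ℝ, 0 < κ →
            (∀ᶠ t in atTop, ξ t = κ * ‖gradient (svmObjective ψ lam x y) (w t)‖) →
            QQuadraticRate w wstar) := by
  obtain ⟨ψ', ψ'', B, K, hloss⟩ : ∃ ψ' ψ'' B K, SmoothConvexLoss ψ ψ' ψ'' B K := by
    rcases hψ with rfl | rfl
    · exact smoothConvexLoss_psiG hσ
    · exact smoothConvexLoss_psiM hσ
  obtain ⟨u, M, hf⟩ := hloss.regularObjective_svmObjective (x := x) (y := y) hlam
  obtain ⟨a, ha⟩ := hf.exists_minimizer
  have ha' := hf.gradient_eq_zero_of_forall_le ha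
  exact ⟨a, fun w hw => hf.lt_of_ne ha' hw,
    fun P hP ξ hξ w Δ s h => h.convergence hf hP hξ ha'⟩
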